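/- **Setting.** Let $G=(V,E)$ be a finite directed graph with $n=|V|\ge 1$ nodes and a triggering model: each node $v$ independently samples a triggering set $T_v$ of in-neighbours from a distribution $D_v$; given a seed set $S$, a node becomes active one step after some node of its triggering set is active, and stays active; $\sigma(S)$ is the expected final number of active nodes. Let $\mathcal D\subseteq\mathbb R_+^d$ be convex, and let $q_{v,j}:\mathbb R_+\to[0,1]$ ($v\in V$, $j\in[d]$) be nondecreasing, concave and $L_q$-Lipschitz. A strategy mix $x\in\mathcal D$ activates each node $v$ as a seed, independently, with probability $h_v(x)=1-\prod_{j}(1-q_{v,j}(x_j))$ (independent strategy activation), and $g(x)=\sum_{S\subseteq V}\sigma(S)\prod_{u\in S}h_u(x)\prod_{v\notin S}(1-h_v(x))$. Let $c:\mathcal D\to\mathbb R$ be convex and $L_c$-Lipschitz, $k\ge0$, $\lambda\ge0$, $s(x)=\lambda(k-c(x))$, and $\mathcal P=\{x\in\mathcal D: c(x)\le k\}$. Assume that $\mathcal P$ is non-empty and closed and has diameter at most $\Delta$, and that $\mathrm{OPT}_{g+s}=\max_{x\in\mathcal P}(g+s)(x)\ge 1$. A random RR set is the set of nodes that reach a uniformly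 random root in the graph of edges $\{(w,u): w\in T_u\}$, for sampled $(T_u)_u$. $\mathcal N(\mathcal P,r)$ is the least size of a finite set within distance $r$ of every point of $\mathcal P$. For a sequence $\mathcal R$ of $\theta$ RR sets let $$\hat g_{\mathcal R}(x)=\frac n\theta\sum_{R\in\mathcal R}\Bigl(1-\prod_{v\in R}(1-h_v(x))\Bigr),\qquad \bar g_{\mathcal R}(x)=\frac n\theta\sum_{R\in\mathcal R}\min\Bigl\{1,\sum_{v\in R,\,j\in[d]}q_{v,j}(x_j)\Bigr\},$$ $\nu^{(1)}(\mathcal R)=\frac1\theta\sum_{R\in\mathcal R}|R|$, $L(\mathcal R)=\nu^{(1)}(\mathcal R)\,n\sqrt d\,L_q+\lambda L_c$. **Gradient algorithm** $\mathcal A(\mathcal R,\delta)$. Run $T=\lceil 9(\Delta L(\mathcal R))^2/\delta^2\rceil$ steps of projected subgradient ascent on $\bar g_{\mathcal R}+s$ over $\mathcal P$ from a given $x_0\in\mathcal P$, with step sizes $\eta_t=\Delta/(L(\mathcal R)\sqrt t)$, $t=1,\dots,T$, and return the best of the $T+1$ iterates with respect to $\bar g_{\mathcal R}+s$. The subgradient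 used at $x$ is $\frac n\theta\sum_{R}u_R-\lambda\,\partial c(x)$, where $u_R=0$ if $\sum_{v\in R,j}q_{v,j}(x_j)\ge1$ and $u_R=\bigl(\sum_{v\in R}q_{v,j}'(x_j)\bigr)_j$ otherwise; here $q_{v,j}'$ and $\partial c$ are arbitrary selections of supergradients of $q_{v,j}$ and subgradients of $c$, bounded in norm by $L_q$ and $L_c$. **UpperGrad-RIS.** Let $\alpha=1-1/e$, $\alpha'=\alpha-\varepsilon/3$, $\varepsilon'=\sqrt2\,\varepsilon/3$, $L_1=L_2=n^2\sqrt d\,L_q+\lambda L_c$. Start with $LB=1$. For $i=1,2,\dots,\lfloor\log_2(n+\lambda k)-1\rfloor$: let $x_i=(n+\lambda k)/2^i$ and $$\theta_i=\Bigl\lceil n\bigl(2+\tfrac23\varepsilon'\bigr)\frac{\ln\mathcal N(\mathcal P,\frac{\varepsilon/3}{L_2}x_i)+\ell\ln n+\ln2+\ln\log_2(n+\lambda k)}{\varepsilon'^2x_i}\Bigr\rceil;$$ extend the current sequence of independent random RR sets to a sequence $\mathcal R_i$ of length $\theta_i$, and let $y_i=\mathcal A(\mathcal R_i,\varepsilon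 x_i/3)$; if $(\hat g_{\mathcal R_i}+s)(y_i)\ge(1+\varepsilon'+\varepsilon/3)x_i$, set $LB=(\hat g_{\mathcal R_i}+s)(y_i)/(1+\varepsilon'+\varepsilon/3)$ and leave the loop. Then let $$\theta^{(1)}=\frac{8n\ln(4n^\ell)}{LB\,(\alpha-\varepsilon/3)^2\varepsilon^2/9},\qquad \theta^{(2)}=\frac{2\alpha' n\ln\bigl(4n^\ell\,\mathcal N(\mathcal P,\frac{\varepsilon/3}{L_1+L_2}LB)\bigr)}{\bigl(\varepsilon/3-\frac14(\alpha-\varepsilon/3)^2\varepsilon/3\bigr)^2LB},$$ generate a sequence $\mathcal R$ of $\lceil\max\{\theta^{(1)},\theta^{(2)}\}\rceil$ fresh independent random RR sets, and output $x=\mathcal A(\mathcal R,\varepsilon\,LB)$. **Theorem.** For all $\varepsilon,\ell>0$, with probability at least $1-\frac1{n^\ell}$, UpperGrad-RIS outputs $x\in\mathcal P$ with $$(g+s)(x)\ \ge\ \Bigl(1-\frac1e-\varepsilon\Bigr)\,\mathrm{OPT}_{g+s}.$$ (Quotients by $0$ in degenerate cases are read as $0$, and so is the logarithm of an infinite covering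 number, which only occurs when $L_1=L_2=0$; a negative number of RR sets is read as $0$.) -/

import Mathlib

open MeasureTheory ProbabilityTheory

open scoped NNReal ENNReal

/-- A social network with its triggering model: every node `v` has a probability distribution
`D v` on the sets of in-neighbours of `v`. -/
structure TriggeringModel (V : Type*) where
  /-- the social network -/
  graph : Digraph V
  /-- the distribution of the triggering set of a node -/
  D : V → PMF (Finset V)
  /-- triggering sets consist of in-neighbours -/
  adj_of_mem_support : ∀ v, ∀ T ∈ (D v).support, ∀ u ∈ T, graph.Adj u v

namespace TriggeringModel

section
variable {V : Type*} [Fintype V]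

open Classical in
theorem sum_prod_D (M : TriggeringModel V) :
    ∑ T : V → Finset V, ∏ v, M.D v (T v) = 1 := by
  have h := Finset.prod_univ_sum (fun _ : V => (Finset.univ : Finset (Finset V)))
    (fun v A => M.D v A)
  rw [Fintype.piFinset_univ] at h
  rw [← h]
  refine Finset.prod_eq_one fun v _ => ?_
  have h1 := (M.D v).tsum_coe
  rwa [tsum_fintype] at h1

open Classical in
/-- The joint law of the triggering sets `(T v)_v`: they are sampled independently. -/
noncomputable def triggerLaw (M : TriggeringModel V) : PMF (V → Finset V) :=
  PMF.ofFintype (fun T => ∏ v, M.D v (T v)) M.sum_prod_D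

open Classical in
/-- The nodes that are active at time `t`, when the seeds are `S` and the sampled triggering
sets are `T`: an active node stays active, and `v` gets activated at time `t + 1` if some node of
`T v` is active at time `t`. -/
noncomputable def activeAt (T : V → Finset V) (S : Finset V) : ℕ → Finset V
  | 0 => S
  | t + 1 => activeAt T S t ∪
      Finset.univ.filter fun v => ∃ u ∈ T v, u ∈ activeAt T S t

open Classical in
/-- The nodes that are active in the end. -/
noncomputable def finalActive (T : V → Finset V) (S : Finset V) : Finset V :=
  Finset.univ.filter fun v => ∃ t, v ∈ activeAt T S t

open Classical in
/-- The influence spread `σ(S)`: the expected number of nodes that are active in the end. -/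
noncomputable def spread (M : TriggeringModel V) (S : Finset V) : ℝ :=
  ∑ T : V → Finset V, (M.triggerLaw T).toReal * ((finalActive T S).card : ℝ)

open Classical in
/-- The nodes that can reach `v` in the live-edge graph `{(w, u) | w ∈ T u}`. -/
noncomputable def reverseReachable (T : V → Finset V) (v : V) : Finset V :=
  Finset.univ.filter fun u => Relation.ReflTransGen (fun w u' => w ∈ T u') u v

/-- The law of a random reverse reachable (RR) set: the root is uniform on `V`, and the triggering
sets are sampled independently of the root. -/
noncomputable def rrLaw [Nonempty V] (M : TriggeringModel V) : PMF (Finset V) :=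
  (PMF.uniformOfFintype V).bind fun v => M.triggerLaw.map fun T => reverseReachable T v

end

end TriggeringModel

/-- An instance of continuous influence maximization with budget saving, in the case of
independent strategy activation, with `d` marketing strategies. -/
structure CIMBS (V : Type*) (d : ℕ) where
  /-- the social network and its triggering model -/
  model : TriggeringModel V
  /-- strategy `j` with amount `a` activates `v` as a seed with probability `q v j a` -/
  q : V → Fin d → ℝ → ℝ
  q_mem : ∀ v j, ∀ a ∈ Set.Ici (0 : ℝ), q v j a ∈ Set.Icc (0 : ℝ) 1
  q_mono : ∀ v j, MonotoneOn (q v j) (Set.Ici 0)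
  q_concave : ∀ v j, ConcaveOn ℝ (Set.Ici 0) (q v j)
  /-- the domain of the strategy mixes -/
  domain : Set (EuclideanSpace ℝ (Fin d))
  domain_nonneg : ∀ x ∈ domain, ∀ j, 0 ≤ x j
  domain_convex : Convex ℝ domain
  /-- the cost function -/
  cost : EuclideanSpace ℝ (Fin d) → ℝ
  cost_convex : ConvexOn ℝ domain cost
  /-- the total budget `k` -/
  budget : ℝ
  budget_nonneg : 0 ≤ budget
  /-- the balance parameter `λ` -/
  lam : ℝ
  lam_nonneg : 0 ≤ lam

namespace CIMBS

section
variable {V : Type*} [Fintype V] {d : ℕ}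

/-- The feasible set `P = {x ∈ domain | c(x) ≤ k}`. -/
def feasible (I : CIMBS V d) : Set (EuclideanSpace ℝ (Fin d)) :=
  {x | x ∈ I.domain ∧ I.cost x ≤ I.budget}

/-- The strategy activation function `h_v(x) = 1 - ∏_j (1 - q_{v,j}(x_j))`. -/
noncomputable def h (I : CIMBS V d) (v : V) (x : EuclideanSpace ℝ (Fin d)) : ℝ :=
  1 - ∏ j, (1 - I.q v j (x j))

open Classical in
/-- The influence spread of a strategy mix:
`g(x) = ∑_{S ⊆ V} σ(S) ∏_{u ∈ S} h_u(x) ∏_{v ∉ S} (1 - h_v(x))`. -/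
noncomputable def g (I : CIMBS V d) (x : EuclideanSpace ℝ (Fin d)) : ℝ :=
  ∑ S : Finset V, I.model.spread S * (∏ u ∈ S, I.h u x) * ∏ v ∈ Sᶜ, (1 - I.h v x)

/-- The budget saving `s(x) = λ (k - c(x))`. -/
def s (I : CIMBS V d) (x : EuclideanSpace ℝ (Fin d)) : ℝ :=
  I.lam * (I.budget - I.cost x)

/-- `OPT_{g+s}`, the optimal value of `g + s` on the feasible set. -/
noncomputable def opt (I : CIMBS V d) : ℝ :=
  sSup ((fun x => I.g x + I.s x) '' I.feasible)

/-! A collection of `θ` RR sets is given as the first `θ` terms of a sequence `R`. -/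

/-- `ĝ_R(x) = (n/θ) ∑_{R} (1 - ∏_{v ∈ R} (1 - h_v(x)))`. -/
noncomputable def gHat (I : CIMBS V d) (R : ℕ → Finset V) (θ : ℕ)
    (x : EuclideanSpace ℝ (Fin d)) : ℝ :=
  (Fintype.card V : ℝ) / θ * ∑ i ∈ Finset.range θ, (1 - ∏ v ∈ R i, (1 - I.h v x))

/-- The concave upper bound `ḡ_R(x) = (n/θ) ∑_{R} min {1, ∑_{v ∈ R, j} q_{v,j}(x_j)}`. -/
noncomputable def gBar (I : CIMBS V d) (R : ℕ → Finset V) (θ : ℕ)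
    (x : EuclideanSpace ℝ (Fin d)) : ℝ :=
  (Fintype.card V : ℝ) / θ *
    ∑ i ∈ Finset.range θ, min 1 (∑ v ∈ R i, ∑ j, I.q v j (x j))

end

/-- The inputs of the algorithm besides the instance itself. -/
structure Input (V : Type*) (d : ℕ) where
  /-- Lipschitz constant of the functions `q v j` -/
  Lq : ℝ≥0
  /-- Lipschitz constant of the cost function -/
  Lc : ℝ≥0
  /-- upper bound of the diameter of the feasible set -/
  Δ : ℝ
  /-- approximation parameter -/
  ε : ℝ
  /-- confidence parameter -/
  ℓ : ℝ
  /-- starting point of the subgradient method -/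
  x₀ : EuclideanSpace ℝ (Fin d)
  /-- supergradients of the functions `q v j` (their derivatives, where these exist) -/
  dq : V → Fin d → ℝ → ℝ
  /-- subgradients of the cost function (its gradient, where it exists) -/
  dc : EuclideanSpace ℝ (Fin d) → EuclideanSpace ℝ (Fin d)

/-- The inputs are as they should be for the instance `I`. The (super-, sub-)gradients can be any;
only, as for gradients, their norms are bounded by the Lipschitz constants. (In the interior of
the domain, this holds for all of them; at a boundary point, where there are arbitrarily large
ones, it says which of them may be used, and there always is one.) -/
structure Input.Valid {V : Type*} {d : ℕ} (p : Input V d) (I : CIMBS V d) : Prop where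
  q_lipschitz : ∀ v j, LipschitzOnWith p.Lq (I.q v j) (Set.Ici 0)
  cost_lipschitz : LipschitzOnWith p.Lc I.cost I.domain
  dist_le : ∀ x ∈ I.feasible, ∀ y ∈ I.feasible, dist x y ≤ p.Δ
  ε_pos : 0 < p.ε
  ℓ_pos : 0 < p.ℓ
  x₀_mem : p.x₀ ∈ I.feasible
  dq_super : ∀ v j, ∀ a ∈ Set.Ici (0 : ℝ), ∀ b ∈ Set.Ici (0 : ℝ),
    I.q v j b ≤ I.q v j a + p.dq v j a * (b - a)
  dq_bound : ∀ v j, ∀ a ∈ Set.Ici (0 : ℝ), |p.dq v j a| ≤ p.Lq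
  dc_sub : ∀ x ∈ I.domain, ∀ y ∈ I.domain, I.cost x + inner ℝ (p.dc x) (y - x) ≤ I.cost y
  dc_bound : ∀ x ∈ I.domain, ‖p.dc x‖ ≤ p.Lc

section
variable {V : Type*} [Fintype V] {d : ℕ}

/-- A point of `P` that is nearest to `y` (it is unique when `P` is closed, convex and
non-empty). -/
noncomputable def proj (P : Set (EuclideanSpace ℝ (Fin d))) (y : EuclideanSpace ℝ (Fin d)) :
    EuclideanSpace ℝ (Fin d) :=
  Classical.epsilon fun z => z ∈ P ∧ ∀ w ∈ P, dist y z ≤ dist y w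

/-- The subgradient of `ḡ_R + s` at `x` that the algorithm uses: an RR set `R` contributes `0` to
the part for `ḡ_R` if `∑_{v ∈ R, j} q_{v,j}(x_j) ≥ 1`, and `∑_{v ∈ R, j} ∇ q_{v,j}(x_j)`
otherwise. -/
noncomputable def subgrad (I : CIMBS V d) (p : Input V d) (R : ℕ → Finset V) (θ : ℕ)
    (x : EuclideanSpace ℝ (Fin d)) : EuclideanSpace ℝ (Fin d) :=
  ((Fintype.card V : ℝ) / θ) • (∑ i ∈ Finset.range θ,
      if 1 ≤ ∑ v ∈ R i, ∑ j, I.q v j (x j) then 0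
      else WithLp.toLp 2 fun j => ∑ v ∈ R i, p.dq v j (x j))
    - I.lam • p.dc x

/-- The average size `ν⁽¹⁾(R)` of the RR sets. -/
noncomputable def avgSize (R : ℕ → Finset V) (θ : ℕ) : ℝ :=
  (∑ i ∈ Finset.range θ, ((R i).card : ℝ)) / θ

/-- The Lipschitz constant `ν⁽¹⁾(R) n √d L_q + λ L_c` of `ḡ_R + s`. -/
noncomputable def lipBar (I : CIMBS V d) (p : Input V d) (R : ℕ → Finset V) (θ : ℕ) : ℝ :=
  avgSize R θ * Fintype.card V * √d * p.Lq + I.lam * p.Lc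

/-- The iterates of the projected subgradient method for `ḡ_R + s` on the feasible set, with
step sizes `η_t = Δ / (L √t)` for `t = 1, 2, …`, where `L` is the Lipschitz constant. -/
noncomputable def iterate (I : CIMBS V d) (p : Input V d) (R : ℕ → Finset V) (θ : ℕ) :
    ℕ → EuclideanSpace ℝ (Fin d)
  | 0 => p.x₀
  | t + 1 => proj I.feasible (iterate I p R θ t +
      (p.Δ / (lipBar I p R θ * √((t : ℝ) + 1))) • subgrad I p R θ (iterate I p R θ t))

open Classical in
/-- The best of the iterates up to time `t`, with respect to `ḡ_R + s`. -/
noncomputable def best (I : CIMBS V d) (p : Input V d) (R : ℕ → Finset V) (θ : ℕ) :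
    ℕ → EuclideanSpace ℝ (Fin d)
  | 0 => iterate I p R θ 0
  | t + 1 =>
      if I.gBar R θ (best I p R θ t) + I.s (best I p R θ t)
          < I.gBar R θ (iterate I p R θ (t + 1)) + I.s (iterate I p R θ (t + 1))
      then iterate I p R θ (t + 1) else best I p R θ t

/-- The gradient algorithm: projected subgradient ascent on `ḡ_R + s`, with error parameter `δ`,
that is, with `T = ⌈9 (Δ L)² / δ²⌉` iterations. -/
noncomputable def upperGrad (I : CIMBS V d) (p : Input V d) (R : ℕ → Finset V) (θ : ℕ)
    (δ : ℝ) : EuclideanSpace ℝ (Fin d) :=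
  best I p R θ ⌈9 * (p.Δ * lipBar I p R θ) ^ 2 / δ ^ 2⌉₊

/-- The approximation ratio `α = 1 - 1/e` of the gradient algorithm. -/
noncomputable def ratio : ℝ := 1 - 1 / Real.exp 1

/-- The Lipschitz constants `L₁ = L₂ = n² √d L_q + λ L_c` of `g + s` and `ĝ_R + s`. -/
noncomputable def lip (I : CIMBS V d) (p : Input V d) : ℝ :=
  (Fintype.card V : ℝ) ^ 2 * √d * p.Lq + I.lam * p.Lc

/-- The covering number `𝒩(P, r)` of the feasible set. -/
noncomputable def covering (I : CIMBS V d) (r : ℝ) : ℝ :=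
  ((Metric.externalCoveringNumber r.toNNReal I.feasible).toNat : ℝ)

/-- `ε' = √2 ε / 3`. -/
noncomputable def epsPrime (p : Input V d) : ℝ := √2 * p.ε / 3

/-- The `i`-th guess `x_i = (n + λ k) / 2^i` of the optimal value. -/
noncomputable def guess (I : CIMBS V d) (i : ℕ) : ℝ :=
  ((Fintype.card V : ℝ) + I.lam * I.budget) / 2 ^ i

/-- The number `θ_i` of RR sets in the `i`-th round of the sampling phase. -/
noncomputable def theta (I : CIMBS V d) (p : Input V d) (i : ℕ) : ℕ :=
  ⌈(Fintype.card V : ℝ) * (2 + 2 / 3 * epsPrime p) *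
    (Real.log (I.covering (p.ε / 3 / lip I p * I.guess i)) + p.ℓ * Real.log (Fintype.card V) +
      Real.log 2 + Real.log (Real.logb 2 ((Fintype.card V : ℝ) + I.lam * I.budget))) /
    (epsPrime p ^ 2 * I.guess i)⌉₊

/-- The value of `ĝ_{R_i} + s` at the output of the gradient algorithm in round `i`, which is
called with the first `θ_i` RR sets of `R` (`θ_i - θ_{i-1}` of them are new) and with error
parameter `ε x_i / 3`. -/
noncomputable def roundValue (I : CIMBS V d) (p : Input V d) (R : ℕ → Finset V) (i : ℕ) : ℝ :=
  I.gHat R (theta I p i) (upperGrad I p R (theta I p i) (p.ε * I.guess i / 3)) +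
    I.s (upperGrad I p R (theta I p i) (p.ε * I.guess i / 3))

open Classical in
/-- The rounds `i, i + 1, …, i + m - 1` of the sampling phase: it stops at the first round that
passes the test, and `LB = 1` if there is none. -/
noncomputable def samplingLoop (I : CIMBS V d) (p : Input V d) (R : ℕ → Finset V) :
    (m i : ℕ) → ℝ
  | 0, _ => 1
  | m + 1, i =>
      if (1 + epsPrime p + p.ε / 3) * I.guess i ≤ roundValue I p R i
      then roundValue I p R i / (1 + epsPrime p + p.ε / 3)
      else samplingLoop I p R m (i + 1)

/-- The estimated lower bound `LB` after the rounds `i = 1, …, ⌊log₂(n + λ k) - 1⌋`. -/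
noncomputable def lowerBound (I : CIMBS V d) (p : Input V d) (R : ℕ → Finset V) : ℝ :=
  samplingLoop I p R
    ⌊Real.logb 2 ((Fintype.card V : ℝ) + I.lam * I.budget) - 1⌋₊ 1

/-- `θ⁽¹⁾ = 8 n ln(4 n^ℓ) / (LB (α - ε/3)² ε²/9)`. -/
noncomputable def theta1 (_I : CIMBS V d) (p : Input V d) (LB : ℝ) : ℝ :=
  8 * (Fintype.card V : ℝ) * Real.log (4 * (Fintype.card V : ℝ) ^ p.ℓ) /
    (LB * (ratio - p.ε / 3) ^ 2 * p.ε ^ 2 / 9)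

/-- `θ⁽²⁾ = 2 α' n ln(4 n^ℓ 𝒩(P, (ε/3) LB / (L₁ + L₂))) / ((ε/3 - (α - ε/3)² (ε/3) / 4)² LB)`,
where `α' = α - ε/3`. -/
noncomputable def theta2 (I : CIMBS V d) (p : Input V d) (LB : ℝ) : ℝ :=
  2 * (ratio - p.ε / 3) * (Fintype.card V : ℝ) *
    Real.log (4 * (Fintype.card V : ℝ) ^ p.ℓ *
      I.covering (p.ε / 3 / (lip I p + lip I p) * LB)) /
    ((p.ε / 3 - 1 / 4 * (ratio - p.ε / 3) ^ 2 * (p.ε / 3)) ^ 2 * LB)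

/-- The final number of RR sets, `max {θ⁽¹⁾, θ⁽²⁾}`, rounded up. -/
noncomputable def thetaFinal (I : CIMBS V d) (p : Input V d) (LB : ℝ) : ℕ :=
  ⌈max (theta1 I p LB) (theta2 I p LB)⌉₊

/-- The output of UpperGrad-RIS. The sampling phase uses RR sets from the sequence `R`; then
fresh RR sets, from the sequence `R'`, are generated, and the gradient algorithm is called with
them and with error parameter `ε LB`. -/
noncomputable def upperGradRIS (I : CIMBS V d) (p : Input V d) (R R' : ℕ → Finset V) :
    EuclideanSpace ℝ (Fin d) :=
  upperGrad I p R' (thetaFinal I p (lowerBound I p R)) (p.ε * lowerBound I p R)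

end

end CIMBS

/-! For fixed triggering sets, a node ends up active exactly when the seeds meet its reverse
reachable set. So $g(x)$ is $n$ times the probability that the random seeds of $x$ hit a random RR
set (`g_eq_sum_rrLaw`), and $\hat g$ is an unbiased average of independent bounded variables.
Moreover $1-\prod(1-q)$ lies between $(1-1/e)\min\{1,\sum q\}$ and $\min\{1,\sum q\}$, so
$(1-1/e)\bar g\le\hat g\le\bar g$, and projected subgradient ascent maximizes $\bar g+s$ up to
$\delta/2$ (`gBar_add_s_le_upperGrad`).

The sampling phase only has to ensure $LB\le\mathrm{OPT}$ (`measure_opt_lt_lowerBound_le`). If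
$LB>\mathrm{OPT}$, some round returned a value of at least
$(1+\varepsilon'+\varepsilon/3)\max\{x_i,\mathrm{OPT}\}$; then $\hat g$ exceeds $g$ by
$\varepsilon'\max\{x_i,\mathrm{OPT}\}$ at a point of a fixed net. Bernstein's inequality and a union
bound over net and rounds make this unlikely.

For the final phase with a fixed $b\le\mathrm{OPT}$ in place of $LB$ (`measure_upperGrad_lt_le`), a
bad output forces one of two events (`exists_net_point_of_lt`): $\hat g$ underestimates $g$ at one
fixed optimal point, or it overestimates $g$ by $\frac\varepsilon3\mathrm{OPT}$ at a net point of
small value. The first is controlled by $\theta^{(1)}$, the second by $\theta^{(2)}$; restricting to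
points of small value is what allows the factor $\alpha'$ in $\theta^{(2)}$.

The actual $LB$ is random but independent of the fresh RR sets, so conditioning on the finitely many
relevant outcomes of the sampling phase (`measure_setOf_mem_comp_le`) reduces to fixed $b$. The two
failure probabilities add up to $n^{-\ell}$. -/

/-! ### Tail bounds for sums of independent $[0,1]$-valued variables -/

section Concentration

/-- Equivalent to the Padé-type bound $(6-2t)e^t\le 6+4t+t^2$. After multiplication by $e^{-t}$ the
difference of the two sides vanishes at $0$, and it is monotone because $1+t+t^2/2\le e^t$. -/
theorem exp_sub_one_sub_le {t : ℝ} (h0 : 0 ≤ t) (h3 : t < 3) :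
    Real.exp t - 1 - t ≤ t ^ 2 / (2 * (1 - t / 3)) := by
  have hmono : MonotoneOn (fun t : ℝ => (6 + 4 * t + t ^ 2) * Real.exp (-t) - 6 + 2 * t)
      (Set.Ici 0) := by
    have hd : ∀ t : ℝ, HasDerivAt
        (fun t : ℝ => (6 + 4 * t + t ^ 2) * Real.exp (-t) - 6 + 2 * t)
        (2 - (2 + 2 * t + t ^ 2) * Real.exp (-t)) t := by
      intro t
      have h1 : HasDerivAt (fun t : ℝ => 6 + 4 * t + t ^ 2) (4 + 2 * t) t := by
        have := ((hasDerivAt_const t (6 : ℝ)).add ((hasDerivAt_id t).const_mul 4)).add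
          (hasDerivAt_pow 2 t)
        refine this.congr_deriv ?_
        norm_num
      have h2 : HasDerivAt (fun t : ℝ => Real.exp (-t)) (-Real.exp (-t)) t := by
        simpa using (hasDerivAt_neg t).exp
      have := ((h1.mul h2).sub_const 6).add ((hasDerivAt_id t).const_mul 2)
      refine this.congr_deriv ?_
      ring
    refine monotoneOn_of_hasDerivWithinAt_nonneg (convex_Ici 0)
      (fun t _ => (hd t).continuousAt.continuousWithinAt)
      (fun t _ => (hd t).hasDerivWithinAt) ?_
    intro t ht
    rw [interior_Ici] at ht
    have hq := Real.quadratic_le_exp_of_nonneg (le_of_lt ht)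
    have : (2 + 2 * t + t ^ 2) * Real.exp (-t) ≤ 2 * Real.exp t * Real.exp (-t) := by
      gcongr
      linarith
    rw [mul_assoc, ← Real.exp_add] at this
    simp only [add_neg_cancel, Real.exp_zero] at this
    linarith
  have h := hmono (Set.mem_Ici.2 le_rfl) (Set.mem_Ici.2 h0) h0
  simp only [neg_zero, Real.exp_zero] at h
  have h' : (6 - 2 * t) * Real.exp t ≤ 6 + 4 * t + t ^ 2 := by
    have h1 : 6 - 2 * t ≤ (6 + 4 * t + t ^ 2) * Real.exp (-t) := by linarith
    calc (6 - 2 * t) * Real.exp t ≤ (6 + 4 * t + t ^ 2) * Real.exp (-t) * Real.exp t := by gcongr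
      _ = 6 + 4 * t + t ^ 2 := by rw [mul_assoc, ← Real.exp_add]; simp
  rw [le_div_iff₀ (by linarith)]
  nlinarith

/-- $(1+t+t^2/2)(1-t+t^2/2)=1+t^4/4\ge1$, and the first factor is at most $e^t$. -/
theorem exp_neg_le_quadratic {t : ℝ} (h0 : 0 ≤ t) :
    Real.exp (-t) ≤ 1 - t + t ^ 2 / 2 := by
  have hq := Real.quadratic_le_exp_of_nonneg h0
  have hpos : 0 ≤ 1 - t + t ^ 2 / 2 := by nlinarith [sq_nonneg (t - 1)]
  rw [Real.exp_neg, inv_le_iff_one_le_mul₀ (Real.exp_pos t)]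
  nlinarith [mul_le_mul_of_nonneg_left hq hpos, sq_nonneg (t ^ 2)]

variable {Ω : Type*} [MeasurableSpace Ω] {μ : Measure Ω} [IsProbabilityMeasure μ]

theorem integrable_exp_mul_of_mem_Icc {X : Ω → ℝ} (hX : Measurable X)
    (h01 : ∀ ω, X ω ∈ Set.Icc (0 : ℝ) 1) (t : ℝ) :
    Integrable (fun ω => Real.exp (t * X ω)) μ := by
  refine Integrable.of_bound (C := Real.exp |t|) (by fun_prop) (ae_of_all _ fun ω => ?_)
  rw [Real.norm_eq_abs, abs_of_pos (Real.exp_pos _), Real.exp_le_exp]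
  obtain ⟨h0, h1⟩ := h01 ω
  calc t * X ω ≤ |t| * X ω := mul_le_mul_of_nonneg_right (le_abs_self t) h0
    _ ≤ |t| * 1 := mul_le_mul_of_nonneg_left h1 (abs_nonneg t)
    _ = |t| := mul_one _

/-- On $[0,1]$ the convex function $X\mapsto e^{tX}$ lies below its chord $1+X(e^t-1)$. -/
theorem mgf_le_exp_of_mem_Icc {X : Ω → ℝ} (hX : Measurable X)
    (h01 : ∀ ω, X ω ∈ Set.Icc (0 : ℝ) 1) (t : ℝ) :
    mgf X μ t ≤ Real.exp (μ[X] * (Real.exp t - 1)) := by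
  have hint : Integrable X μ :=
    Integrable.of_bound (C := 1) hX.aestronglyMeasurable (ae_of_all _ fun ω => by
      rw [Real.norm_eq_abs, abs_of_nonneg (h01 ω).1]; exact (h01 ω).2)
  calc mgf X μ t ≤ ∫ ω, (1 + X ω * (Real.exp t - 1)) ∂μ := by
        refine integral_mono (integrable_exp_mul_of_mem_Icc hX h01 t)
          ((integrable_const _).add (hint.mul_const _)) fun ω => ?_
        obtain ⟨h0, h1⟩ := h01 ω
        have := convexOn_exp.2 (Set.mem_univ 0) (Set.mem_univ t) (sub_nonneg.2 h1) h0 (by ring)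
        simp only [smul_eq_mul, mul_zero, zero_add, Real.exp_zero, mul_one] at this
        rw [mul_comm t]
        linarith
    _ = 1 + μ[X] * (Real.exp t - 1) := by
        rw [integral_add (integrable_const _) (hint.mul_const _), integral_mul_const]
        simp
    _ ≤ _ := by linarith [Real.add_one_le_exp (μ[X] * (Real.exp t - 1))]

variable {X : ℕ → Ω → ℝ} {m a p : ℝ}

theorem mgf_sum_range_le (hind : iIndepFun X μ) (hX : ∀ i, Measurable (X i))
    (h01 : ∀ i ω, X i ω ∈ Set.Icc (0 : ℝ) 1) (hp : ∀ i, μ[X i] = p) (θ : ℕ) (t : ℝ) :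
    mgf (∑ i ∈ Finset.range θ, X i) μ t ≤ Real.exp (θ * (p * (Real.exp t - 1))) := by
  rw [hind.mgf_sum hX, Real.exp_nat_mul]
  calc ∏ i ∈ Finset.range θ, mgf (X i) μ t
      ≤ ∏ _i ∈ Finset.range θ, Real.exp (p * (Real.exp t - 1)) :=
        Finset.prod_le_prod (fun _ _ => mgf_nonneg) fun i _ =>
          (hp i) ▸ mgf_le_exp_of_mem_Icc (hX i) (h01 i) t
    _ = _ := by simp

/-- Bernstein's inequality for the upper tail of a sum of independent `[0, 1]`-valued variables
whose mean is at most `m`. -/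
theorem measure_sum_ge_le (hind : iIndepFun X μ) (hX : ∀ i, Measurable (X i))
    (h01 : ∀ i ω, X i ω ∈ Set.Icc (0 : ℝ) 1) (hp : ∀ i, μ[X i] = p) (hpm : p ≤ m)
    (hm : 0 < m) (ha : 0 < a) (θ : ℕ) :
    μ.real {ω | θ * (p + a) ≤ ∑ i ∈ Finset.range θ, X i ω} ≤
      Real.exp (-(θ * (a ^ 2 / (2 * m + 2 / 3 * a)))) := by
  -- With this choice $1-t/3=m/(m+a/3)$, and the exponent per variable becomes $-ta/2$.
  set t := a / (m + a / 3) with ht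
  have hma : 0 < m + a / 3 := by positivity
  have ht0 : 0 < t := by positivity
  have ht3 : t < 3 := by rw [ht, div_lt_iff₀ hma]; linarith
  have hint := hind.integrable_exp_mul_sum hX (s := Finset.range θ)
    (fun i _ => integrable_exp_mul_of_mem_Icc (μ := μ) (hX i) (h01 i) t)
  have h := measure_ge_le_exp_mul_mgf (μ := μ) (θ * (p + a)) ht0.le hint
  simp only [Finset.sum_apply] at h
  refine h.trans ?_
  calc _ ≤ Real.exp (-t * (θ * (p + a))) * Real.exp (θ * (p * (Real.exp t - 1))) := by
        gcongr
        exact mgf_sum_range_le hind hX h01 hp θ t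
    -- Splitting off the linear term leaves $p$ with a nonnegative coefficient, so $p$ can be
    -- replaced by its upper bound $m$ there while the deviation stays relative to $p$.
    _ = Real.exp (θ * (p * (Real.exp t - 1 - t) - t * a)) := by
        rw [← Real.exp_add]; ring_nf
    _ ≤ Real.exp (θ * (m * (t ^ 2 / (2 * (1 - t / 3))) - t * a)) := by
        have h1 := exp_sub_one_sub_le ht0.le ht3
        have h0 : 0 ≤ Real.exp t - 1 - t := by linarith [Real.add_one_le_exp t]
        gcongr
    _ = _ := by
        have h13 : 1 - t / 3 = m / (m + a / 3) := by rw [ht]; field_simp; ring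
        congr 1
        rw [h13, ht]
        field_simp
        ring

/-- Chernoff's inequality for the lower tail of a sum of independent `[0, 1]`-valued variables
whose mean is at most `m`. -/
theorem measure_sum_le_le (hind : iIndepFun X μ) (hX : ∀ i, Measurable (X i))
    (h01 : ∀ i ω, X i ω ∈ Set.Icc (0 : ℝ) 1) (hp : ∀ i, μ[X i] = p) (hpm : p ≤ m)
    (hm : 0 < m) (ha : 0 < a) (θ : ℕ) :
    μ.real {ω | ∑ i ∈ Finset.range θ, X i ω ≤ θ * (p - a)} ≤
      Real.exp (-(θ * (a ^ 2 / (2 * m)))) := by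
  have hp0 : 0 ≤ p := hp 0 ▸ integral_nonneg fun ω => (h01 0 ω).1
  set t := a / m with ht
  have ht0 : 0 < t := by positivity
  have hint := hind.integrable_exp_mul_sum hX (s := Finset.range θ)
    (fun i _ => integrable_exp_mul_of_mem_Icc (μ := μ) (hX i) (h01 i) (-t))
  have h := measure_le_le_exp_mul_mgf (μ := μ) (θ * (p - a)) (neg_nonpos.2 ht0.le) hint
  simp only [Finset.sum_apply] at h
  refine h.trans ?_
  calc _ ≤ Real.exp (-(-t) * (θ * (p - a))) * Real.exp (θ * (p * (Real.exp (-t) - 1))) := by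
        gcongr
        exact mgf_sum_range_le hind hX h01 hp θ (-t)
    _ = Real.exp (θ * (p * (Real.exp (-t) - 1 + t) - t * a)) := by
        rw [← Real.exp_add]; ring_nf
    _ ≤ Real.exp (θ * (m * (t ^ 2 / 2) - t * a)) := by
        have h1 : Real.exp (-t) - 1 + t ≤ t ^ 2 / 2 := by linarith [exp_neg_le_quadratic ht0.le]
        have h0 : 0 ≤ Real.exp (-t) - 1 + t := by linarith [Real.add_one_le_exp (-t)]
        gcongr
    _ = _ := by
        congr 1
        rw [ht]
        field_simp
        ring

end Concentration

/-! ### Diffusion and reverse reachability -/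

namespace TriggeringModel

variable {V : Type*} [Fintype V]

/-- Activation is propagation along live-edge paths: one direction is by induction on time, the
other by induction on the path. -/
theorem mem_finalActive_iff {T : V → Finset V} {S : Finset V} {v : V} :
    v ∈ finalActive T S ↔ ∃ u ∈ S, u ∈ reverseReachable T v := by
  classical
  simp only [finalActive, reverseReachable, Finset.mem_filter, Finset.mem_univ, true_and]
  constructor
  · rintro ⟨t, ht⟩
    induction t generalizing v with
    | zero => exact ⟨v, ht, .refl⟩
    | succ t ih =>
      simp only [activeAt, Finset.mem_union, Finset.mem_filter, Finset.mem_univ, true_and] at ht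
      rcases ht with ht | ⟨u, hu, hut⟩
      · exact ih ht
      · obtain ⟨w, hw, hwu⟩ := ih hut
        exact ⟨w, hw, hwu.tail hu⟩
  · rintro ⟨u, hu, huv⟩
    induction huv with
    | refl => exact ⟨0, hu⟩
    | tail _ hbc ih =>
      obtain ⟨t, ht⟩ := ih
      refine ⟨t + 1, ?_⟩
      simp only [activeAt, Finset.mem_union, Finset.mem_filter, Finset.mem_univ, true_and]
      exact Or.inr ⟨_, hbc, ht⟩

open Classical in
theorem card_finalActive (T : V → Finset V) (S : Finset V) :
    ((finalActive T S).card : ℝ) =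
      ∑ v, if ∃ u ∈ S, u ∈ reverseReachable T v then (1 : ℝ) else 0 := by
  rw [Finset.sum_boole]
  congr 2
  ext v
  simp [mem_finalActive_iff]

open Classical in
theorem sum_rrLaw [Nonempty V] (M : TriggeringModel V) (f : Finset V → ℝ) :
    ∑ A, (M.rrLaw A).toReal * f A =
      (Fintype.card V : ℝ)⁻¹ *
        ∑ v, ∑ T, (M.triggerLaw T).toReal * f (reverseReachable T v) := by
  have h : ∀ A, (M.rrLaw A).toReal = (Fintype.card V : ℝ)⁻¹ *
      ∑ v, ∑ T, if A = reverseReachable T v then (M.triggerLaw T).toReal else 0 := by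
    intro A
    rw [rrLaw, PMF.bind_apply, tsum_fintype, ENNReal.toReal_sum, Finset.mul_sum]
    · refine Finset.sum_congr rfl fun v _ => ?_
      rw [ENNReal.toReal_mul, PMF.uniformOfFintype_apply, PMF.map_apply, tsum_fintype,
        ENNReal.toReal_sum]
      · simp only [ENNReal.toReal_inv, ENNReal.toReal_natCast]
        congr 1
        refine Finset.sum_congr rfl fun T _ => ?_
        split_ifs <;> simp
      · intro T _
        split_ifs
        · exact PMF.apply_ne_top _ _
        · simp
    · intro v _
      exact ENNReal.mul_ne_top (PMF.apply_ne_top _ _) (PMF.apply_ne_top _ _)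
  simp only [h, mul_assoc, Finset.sum_mul, ← Finset.mul_sum]
  congr 1
  rw [Finset.sum_comm]
  refine Finset.sum_congr rfl fun v _ => ?_
  rw [Finset.sum_comm]
  refine Finset.sum_congr rfl fun T _ => ?_
  simp

theorem sum_rrLaw_eq_one [Nonempty V] (M : TriggeringModel V) :
    ∑ A, (M.rrLaw A).toReal = 1 := by
  rw [← ENNReal.toReal_sum fun A _ => PMF.apply_ne_top _ _, ← tsum_fintype (L := .unconditional _), PMF.tsum_coe]
  simp

end TriggeringModel

/-! ### Products of probabilities -/

-- Both sides are the probability that independently drawn seeds meet $A$. The probability of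
-- missing $A$ comes from expanding the product after setting `h` to $0$ on $A$ in the seed factors
-- only.
open Classical in
theorem sum_prod_mul_prod_compl_inter {V : Type*} [Fintype V] (h : V → ℝ) (A : Finset V) :
    ∑ S : Finset V, (∏ u ∈ S, h u) * (∏ v ∈ Sᶜ, (1 - h v)) *
      (if ∃ u ∈ S, u ∈ A then (1 : ℝ) else 0) = 1 - ∏ v ∈ A, (1 - h v) := by
  have h1 : ∑ S : Finset V, (∏ u ∈ S, h u) * (∏ v ∈ Sᶜ, (1 - h v)) = 1 := by
    rw [← Fintype.prod_add]
    simp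
  have h2 : ∑ S : Finset V, (∏ u ∈ S, if u ∈ A then 0 else h u) * (∏ v ∈ Sᶜ, (1 - h v)) =
      ∏ v ∈ A, (1 - h v) := by
    rw [← Fintype.prod_add, ← Finset.prod_subset (Finset.subset_univ A)]
    · exact Finset.prod_congr rfl fun v hv => by simp [hv]
    · intro v _ hv
      simp [hv]
  refine Eq.trans ?_ (congrArg₂ (· - ·) h1 h2)
  rw [← Finset.sum_sub_distrib]
  refine Finset.sum_congr rfl fun S _ => ?_
  split_ifs with hS
  · obtain ⟨u, hu, huA⟩ := hS
    rw [Finset.prod_eq_zero hu (f := fun u => if u ∈ A then 0 else h u) (by simp [huA])]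
    ring
  · have : (∏ u ∈ S, if u ∈ A then 0 else h u) = ∏ u ∈ S, h u :=
      Finset.prod_congr rfl fun u hu => by rw [if_neg fun hA => hS ⟨u, hu, hA⟩]
    rw [this]
    ring

/-- Exchange one factor at a time. Positive parts instead of absolute values keep track of the
direction of change, which `gHat_sub_g_sub_le` exploits. -/
theorem prod_sub_prod_le_sum_posPart {ι : Type*} (s : Finset ι) {a b : ι → ℝ}
    (ha : ∀ i ∈ s, a i ∈ Set.Icc (0 : ℝ) 1) (hb : ∀ i ∈ s, b i ∈ Set.Icc (0 : ℝ) 1) :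
    ∏ i ∈ s, a i - ∏ i ∈ s, b i ≤ ∑ i ∈ s, max (a i - b i) 0 := by
  classical
  induction s using Finset.induction_on with
  | empty => simp
  | insert i s hi ih =>
    rw [Finset.prod_insert hi, Finset.prod_insert hi, Finset.sum_insert hi]
    have ih' := ih (fun j hj => ha j (Finset.mem_insert_of_mem hj))
      (fun j hj => hb j (Finset.mem_insert_of_mem hj))
    have hP0 : 0 ≤ ∏ j ∈ s, a j :=
      Finset.prod_nonneg fun j hj => (ha j (Finset.mem_insert_of_mem hj)).1
    have hP1 : ∏ j ∈ s, a j ≤ 1 :=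
      Finset.prod_le_one (fun j hj => (ha j (Finset.mem_insert_of_mem hj)).1)
        fun j hj => (ha j (Finset.mem_insert_of_mem hj)).2
    obtain ⟨hb0, hb1⟩ := hb i (Finset.mem_insert_self i s)
    have h0 : 0 ≤ ∑ j ∈ s, max (a j - b j) 0 := Finset.sum_nonneg fun j _ => le_max_right _ _
    have e1 : (a i - b i) * ∏ j ∈ s, a j ≤ max (a i - b i) 0 :=
      calc _ ≤ max (a i - b i) 0 * ∏ j ∈ s, a j := by gcongr; exact le_max_left _ _
        _ ≤ max (a i - b i) 0 * 1 := by gcongr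
        _ = _ := mul_one _
    have e2 : b i * (∏ j ∈ s, a j - ∏ j ∈ s, b j) ≤ ∑ j ∈ s, max (a j - b j) 0 :=
      calc _ ≤ b i * ∑ j ∈ s, max (a j - b j) 0 := by gcongr
        _ ≤ 1 * ∑ j ∈ s, max (a j - b j) 0 := by gcongr
        _ = _ := one_mul _
    linarith [e1, e2, show a i * ∏ j ∈ s, a j - b i * ∏ j ∈ s, b j =
      (a i - b i) * ∏ j ∈ s, a j + b i * (∏ j ∈ s, a j - ∏ j ∈ s, b j) by ring]

theorem one_sub_prod_one_sub_le_sum {ι : Type*} (s : Finset ι) {q : ι → ℝ}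
    (hq : ∀ i ∈ s, q i ∈ Set.Icc (0 : ℝ) 1) :
    1 - ∏ i ∈ s, (1 - q i) ≤ ∑ i ∈ s, q i := by
  have := prod_sub_prod_le_sum_posPart s (a := fun _ => 1) (b := fun i => 1 - q i)
    (fun _ _ => ⟨zero_le_one, le_rfl⟩)
    (fun i hi => ⟨by linarith [(hq i hi).2], by linarith [(hq i hi).1]⟩)
  simp only [Finset.prod_const_one, sub_sub_cancel] at this
  refine this.trans (Finset.sum_le_sum fun i hi => max_le le_rfl (hq i hi).1)

/-- On $[0,1]$ the concave function $1-e^{-t}$ lies above its chord, whose slope is $1-1/e$; beyond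
$1$ it increases while the left side is constant. -/
theorem one_sub_exp_neg_ge_mul_min {t : ℝ} (ht : 0 ≤ t) :
    (1 - 1 / Real.exp 1) * min 1 t ≤ 1 - Real.exp (-t) := by
  rw [one_div, ← Real.exp_neg]
  have he : Real.exp (-1) ≤ 1 := Real.exp_le_one_iff.2 (by norm_num)
  rcases le_total t 1 with h | h
  · rw [min_eq_right h]
    have := convexOn_exp.2 (Set.mem_univ 0) (Set.mem_univ (-1)) (sub_nonneg.2 h) ht (by ring)
    simp only [smul_eq_mul, mul_zero, zero_add, Real.exp_zero, mul_one] at this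
    rw [show t * -1 = -t by ring] at this
    linarith
  · rw [min_eq_left h, mul_one]
    have : Real.exp (-t) ≤ Real.exp (-1) := Real.exp_le_exp.2 (by linarith)
    linarith

theorem prod_one_sub_le_exp_neg_sum {ι : Type*} (s : Finset ι) {q : ι → ℝ}
    (hq : ∀ i ∈ s, q i ≤ 1) : ∏ i ∈ s, (1 - q i) ≤ Real.exp (-∑ i ∈ s, q i) := by
  rw [← Finset.sum_neg_distrib, Real.exp_sum]
  exact Finset.prod_le_prod (fun i hi => by linarith [hq i hi])
    fun i _ => Real.one_sub_le_exp_neg (q i)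

/-! ### Hit probabilities, and how $g$, $\hat g$ and $\bar g$ compare -/

namespace CIMBS

variable {V : Type*} {d : ℕ} (I : CIMBS V d)

/-- The probability that a strategy mix seeds some node of `A`. -/
noncomputable def hitProb (A : Finset V) (x : EuclideanSpace ℝ (Fin d)) : ℝ :=
  1 - ∏ v ∈ A, (1 - I.h v x)

theorem hitProb_eq_prod (A : Finset V) (x : EuclideanSpace ℝ (Fin d)) :
    I.hitProb A x = 1 - ∏ i ∈ A ×ˢ Finset.univ, (1 - I.q i.1 i.2 (x i.2)) := by
  simp [hitProb, h, Finset.prod_product]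

variable {I} {x z : EuclideanSpace ℝ (Fin d)}

theorem one_sub_q_mem_Icc (hx : ∀ j, 0 ≤ x j) (v : V) (j : Fin d) :
    1 - I.q v j (x j) ∈ Set.Icc (0 : ℝ) 1 :=
  ⟨by linarith [(I.q_mem v j _ (hx j)).2], by linarith [(I.q_mem v j _ (hx j)).1]⟩

theorem hitProb_mem_Icc (hx : ∀ j, 0 ≤ x j) (A : Finset V) :
    I.hitProb A x ∈ Set.Icc (0 : ℝ) 1 := by
  rw [hitProb_eq_prod]
  have h0 : 0 ≤ ∏ i ∈ A ×ˢ Finset.univ, (1 - I.q i.1 i.2 (x i.2)) :=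
    Finset.prod_nonneg fun i _ => (one_sub_q_mem_Icc hx i.1 i.2).1
  have h1 : ∏ i ∈ A ×ˢ Finset.univ, (1 - I.q i.1 i.2 (x i.2)) ≤ 1 :=
    Finset.prod_le_one (fun i _ => (one_sub_q_mem_Icc hx i.1 i.2).1)
      fun i _ => (one_sub_q_mem_Icc hx i.1 i.2).2
  constructor <;> linarith

theorem hitProb_le_min (hx : ∀ j, 0 ≤ x j) (A : Finset V) :
    I.hitProb A x ≤ min 1 (∑ v ∈ A, ∑ j, I.q v j (x j)) := by
  refine le_min (hitProb_mem_Icc hx A).2 ?_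
  rw [hitProb_eq_prod, ← Finset.sum_product']
  exact one_sub_prod_one_sub_le_sum _ fun i _ => I.q_mem i.1 i.2 _ (hx i.2)

theorem ratio_mul_min_le_hitProb (hx : ∀ j, 0 ≤ x j) (A : Finset V) :
    ratio * min 1 (∑ v ∈ A, ∑ j, I.q v j (x j)) ≤ I.hitProb A x := by
  rw [hitProb_eq_prod, ← Finset.sum_product']
  have h1 := prod_one_sub_le_exp_neg_sum (A ×ˢ Finset.univ)
    (q := fun i : V × Fin d => I.q i.1 i.2 (x i.2)) fun i _ => (I.q_mem i.1 i.2 _ (hx i.2)).2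
  have h2 := one_sub_exp_neg_ge_mul_min
    (t := ∑ i ∈ A ×ˢ Finset.univ, I.q i.1 i.2 (x i.2))
    (Finset.sum_nonneg fun i _ => (I.q_mem i.1 i.2 _ (hx i.2)).1)
  unfold ratio
  linarith

/-- As the activation probabilities are nondecreasing, only coordinates that increase from `x` to
`z` can raise the hit probability. -/
theorem hitProb_sub_le {K : ℝ≥0} (hK : ∀ v j, LipschitzOnWith K (I.q v j) (Set.Ici 0))
    (hx : ∀ j, 0 ≤ x j) (hz : ∀ j, 0 ≤ z j) (A : Finset V) :
    I.hitProb A z - I.hitProb A x ≤ A.card * (K * ∑ j, max (z j - x j) 0) := by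
  have h := prod_sub_prod_le_sum_posPart (A ×ˢ Finset.univ)
    (a := fun i : V × Fin d => 1 - I.q i.1 i.2 (x i.2))
    (b := fun i : V × Fin d => 1 - I.q i.1 i.2 (z i.2))
    (fun i _ => one_sub_q_mem_Icc hx i.1 i.2) (fun i _ => one_sub_q_mem_Icc hz i.1 i.2)
  rw [hitProb_eq_prod, hitProb_eq_prod]
  refine le_trans (by linarith) (h.trans ?_)
  rw [Finset.sum_product, ← nsmul_eq_mul]
  refine Finset.sum_le_card_nsmul _ _ _ fun v _ => ?_
  rw [Finset.mul_sum]
  refine Finset.sum_le_sum fun j _ => max_le ?_ (by positivity)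
  rw [sub_sub_sub_cancel_left]
  rcases le_total (x j) (z j) with hxz | hxz
  · have := (hK v j).dist_le_mul (z j) (hz j) (x j) (hx j)
    rw [Real.dist_eq, Real.dist_eq, abs_of_nonneg (sub_nonneg.2 hxz)] at this
    rw [max_eq_left (sub_nonneg.2 hxz)]
    exact (le_abs_self _).trans this
  · have := I.q_mono v j (hz j) (hx j) hxz
    exact le_trans (by linarith) (mul_nonneg K.2 (le_max_right _ _))

variable [Fintype V]

theorem gHat_eq (R : ℕ → Finset V) (θ : ℕ) (x : EuclideanSpace ℝ (Fin d)) :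
    I.gHat R θ x = (Fintype.card V : ℝ) / θ * ∑ i ∈ Finset.range θ, I.hitProb (R i) x := rfl

theorem gHat_le_gBar (hx : ∀ j, 0 ≤ x j) (R : ℕ → Finset V) (θ : ℕ) :
    I.gHat R θ x ≤ I.gBar R θ x := by
  rw [gHat_eq, gBar]
  gcongr
  exact hitProb_le_min hx _

theorem ratio_mul_gBar_le_gHat (hx : ∀ j, 0 ≤ x j) (R : ℕ → Finset V) (θ : ℕ) :
    ratio * I.gBar R θ x ≤ I.gHat R θ x := by
  rw [gHat_eq, gBar, mul_left_comm, Finset.mul_sum]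
  gcongr
  exact ratio_mul_min_le_hitProb hx _

/-- Unbiasedness of $\hat g$: write the spread as a sum over nodes $v$ of the indicator that the
seeds meet the RR set of $v$, then average over the seeds first. -/
theorem g_eq_sum_rrLaw [Nonempty V] (I : CIMBS V d) (x : EuclideanSpace ℝ (Fin d)) :
    I.g x = (Fintype.card V : ℝ) * ∑ A, (I.model.rrLaw A).toReal * I.hitProb A x := by
  classical
  rw [TriggeringModel.sum_rrLaw, mul_inv_cancel_left₀ (by simp)]
  simp only [g, TriggeringModel.spread, hitProb, TriggeringModel.card_finalActive,
    ← sum_prod_mul_prod_compl_inter, Finset.mul_sum, Finset.sum_mul]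
  rw [Finset.sum_comm]
  conv_rhs => rw [Finset.sum_comm]
  refine Finset.sum_congr rfl fun T _ => ?_
  rw [Finset.sum_comm]
  refine Finset.sum_congr rfl fun v _ => Finset.sum_congr rfl fun S _ => ?_
  ring

end CIMBS

/-! ### Projected subgradient method -/

namespace CIMBS

section Projection

variable {d : ℕ} {P : Set (EuclideanSpace ℝ (Fin d))}

theorem proj_spec (hP : IsClosed P) (hne : P.Nonempty) (y : EuclideanSpace ℝ (Fin d)) :
    proj P y ∈ P ∧ ∀ w ∈ P, dist y (proj P y) ≤ dist y w := by
  refine Classical.epsilon_spec (p := fun z => z ∈ P ∧ ∀ w ∈ P, dist y z ≤ dist y w) ?_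
  obtain ⟨z, hz, hyz⟩ := hP.exists_infDist_eq_dist hne y
  exact ⟨z, hz, fun w hw => hyz ▸ Metric.infDist_le_dist_of_mem hw⟩

/-- At the projection, the directions to `y` and to any point of `P` form an angle of at least
$90°$. -/
theorem dist_proj_le (hP : IsClosed P) (hc : Convex ℝ P) {w : EuclideanSpace ℝ (Fin d)}
    (hw : w ∈ P) (y : EuclideanSpace ℝ (Fin d)) : dist (proj P y) w ≤ dist y w := by
  obtain ⟨hmem, hmin⟩ := proj_spec hP ⟨w, hw⟩ y
  have : Nonempty P := ⟨⟨w, hw⟩⟩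
  have hinf : ‖y - proj P y‖ = ⨅ w : P, ‖y - w‖ := by
    refine le_antisymm (le_ciInf fun v => ?_)
      (ciInf_le ⟨0, Set.forall_mem_range.2 fun v => norm_nonneg _⟩ (⟨_, hmem⟩ : P))
    simpa [dist_eq_norm] using hmin v v.2
  have hin := (norm_eq_iInf_iff_real_inner_le_zero hc hmem).1 hinf w hw
  rw [dist_eq_norm, dist_eq_norm]
  refine le_of_sq_le_sq ?_ (norm_nonneg _)
  have h := norm_add_sq_real (y - proj P y) (proj P y - w)
  rw [sub_add_sub_cancel] at h
  have hneg : inner ℝ (y - proj P y) (proj P y - w) =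
      -inner ℝ (y - proj P y) (w - proj P y) := by
    rw [← inner_neg_right, neg_sub]
  nlinarith [sq_nonneg ‖y - proj P y‖]

/-- Expanding the squared distance to `y` bounds its change in each step. Dividing by the step size
weights these changes by $L\sqrt{t+1}/\Delta$; the first term on the right is what summation by
parts leaves, kept so that the induction closes. The second comes from
$1/\sqrt{t+1}\le2(\sqrt{t+1}-\sqrt t)$. -/
theorem two_mul_le_of_subgradient_steps {E : Type*} [NormedAddCommGroup E]
    [InnerProductSpace ℝ E] {x u : ℕ → E} {y : E} {Δ L γ : ℝ} (hΔ : 0 < Δ) (hL : 0 < L)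
    (hdist : ∀ t, dist (x t) y ≤ Δ) (hu : ∀ t, ‖u t‖ ≤ L)
    (hstep : ∀ t : ℕ, dist (x (t + 1)) y ≤ dist (x t + (Δ / (L * √((t : ℝ) + 1))) • u t) y)
    (T : ℕ) (hγ : ∀ t ≤ T, γ ≤ inner ℝ (u t) (y - x t)) :
    2 * γ * T ≤ L / Δ * (Δ ^ 2 - dist (x T) y ^ 2) * √T + 2 * Δ * L * √T := by
  induction T with
  | zero => simp
  | succ T ih =>
    have ih' := ih fun t ht => hγ t (ht.trans T.le_succ)
    set r := √((T : ℝ) + 1) with hr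
    have hr0 : 0 < r := Real.sqrt_pos.2 (by positivity)
    have hr2 : r ^ 2 = T + 1 := Real.sq_sqrt (by positivity)
    set r' := √(T : ℝ) with hr'
    have hr'0 : 0 ≤ r' := Real.sqrt_nonneg _
    have hr'2 : r' ^ 2 = T := Real.sq_sqrt (by positivity)
    have hrr : r' ≤ r := Real.sqrt_le_sqrt (by linarith)
    push_cast
    rw [← hr]
    set D := dist (x T) y with hD
    set D' := dist (x (T + 1)) y with hD'
    have hDΔ : D ^ 2 ≤ Δ ^ 2 := by
      have := hdist T
      gcongr
    set η := Δ / (L * r) with hη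
    have hη0 : 0 < η := by positivity
    have h1 : D' ^ 2 ≤ D ^ 2 - 2 * η * γ + η ^ 2 * L ^ 2 := by
      have h2 : D' ^ 2 ≤ dist (x T + η • u T) y ^ 2 := by
        have := hstep T
        gcongr
      refine h2.trans ?_
      rw [hD, dist_eq_norm, dist_eq_norm, show x T + η • u T - y = (x T - y) + η • u T by abel,
        norm_add_sq_real, inner_smul_right, norm_smul, mul_pow, Real.norm_eq_abs, sq_abs]
      have h3 : inner ℝ (x T - y) (u T) = -inner ℝ (u T) (y - x T) := by
        rw [real_inner_comm, ← inner_neg_right, neg_sub]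
      have h4 : η * γ ≤ η * inner ℝ (u T) (y - x T) := by
        have := hγ T T.le_succ
        gcongr
      have h5 : η ^ 2 * ‖u T‖ ^ 2 ≤ η ^ 2 * L ^ 2 := by
        have := hu T
        gcongr
      rw [h3]
      linarith
    have h6 : 2 * γ ≤ L / Δ * (D ^ 2 - D' ^ 2) * r + Δ * L / r := by
      have h7 : L * r / Δ * (2 * η * γ) ≤ L * r / Δ * (D ^ 2 - D' ^ 2 + η ^ 2 * L ^ 2) := by
        gcongr
        linarith
      have e1 : L * r / Δ * (2 * η * γ) = 2 * γ := by rw [hη]; field_simp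
      have e2 : L * r / Δ * (D ^ 2 - D' ^ 2 + η ^ 2 * L ^ 2) =
          L / Δ * (D ^ 2 - D' ^ 2) * r + Δ * L / r := by
        rw [hη]; field_simp
      rwa [e1, e2] at h7
    -- The weight may be raised from $\sqrt T$ to $\sqrt{T+1}$ because all distances to `y` are at
    -- most `Δ`.
    have h8 : L / Δ * (Δ ^ 2 - D ^ 2) * r' ≤ L / Δ * (Δ ^ 2 - D ^ 2) * r := by
      have : 0 ≤ Δ ^ 2 - D ^ 2 := by linarith
      gcongr
    have h9 : 1 / r ≤ 2 * r - 2 * r' := by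
      rw [div_le_iff₀ hr0]
      nlinarith [sq_nonneg (r - r')]
    have h10 : Δ * L / r ≤ Δ * L * (2 * r - 2 * r') := by
      rw [div_eq_mul_one_div]
      gcongr
    have e3 : L / Δ * (Δ ^ 2 - D ^ 2) * r + L / Δ * (D ^ 2 - D' ^ 2) * r =
        L / Δ * (Δ ^ 2 - D' ^ 2) * r := by ring
    linarith

theorem norm_toLp_le {f : Fin d → ℝ} {c : ℝ} (hc : 0 ≤ c) (hf : ∀ j, |f j| ≤ c) :
    ‖WithLp.toLp 2 f‖ ≤ √d * c := by
  rw [EuclideanSpace.norm_eq]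
  refine Real.sqrt_le_iff.2 ⟨by positivity, ?_⟩
  rw [mul_pow, Real.sq_sqrt (by positivity), ← nsmul_eq_mul]
  refine (Finset.sum_le_card_nsmul Finset.univ _ (c ^ 2) fun j _ => ?_).trans (by simp)
  simp only [Real.norm_eq_abs]
  have := hf j
  gcongr

theorem sum_abs_sub_le (x z : EuclideanSpace ℝ (Fin d)) :
    ∑ j, |x j - z j| ≤ √d * dist x z := by
  rw [EuclideanSpace.dist_eq, ← Real.sqrt_mul (by positivity)]
  refine Real.le_sqrt_of_sq_le ?_
  simpa [Real.dist_eq] using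
    sq_sum_le_card_mul_sum_sq (s := Finset.univ) (f := fun j => |x j - z j|)

theorem sum_posPart_le (x z : EuclideanSpace ℝ (Fin d)) :
    ∑ j, max (z j - x j) 0 ≤ √d * dist x z := by
  rw [dist_comm]
  exact (Finset.sum_le_sum fun j _ => max_le (le_abs_self _) (abs_nonneg _)).trans
    (sum_abs_sub_le z x)

theorem sum_posPart_add_sum_posPart_le (x z : EuclideanSpace ℝ (Fin d)) :
    ∑ j, max (z j - x j) 0 + ∑ j, max (x j - z j) 0 ≤ √d * dist x z := by
  rw [← Finset.sum_add_distrib]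
  refine (Finset.sum_le_sum fun j _ => ?_).trans (sum_abs_sub_le x z)
  rcases le_total (x j) (z j) with h | h
  · rw [max_eq_left (by linarith), max_eq_right (by linarith), abs_of_nonpos (by linarith)]
    linarith
  · rw [max_eq_right (by linarith), max_eq_left (by linarith), abs_of_nonneg (by linarith)]
    linarith

end Projection

/-! ### The feasible set and its nets -/

section Feasible

variable {V : Type*} {d : ℕ} {I : CIMBS V d} {p : Input V d}

theorem feasible_convex (I : CIMBS V d) : Convex ℝ I.feasible :=
  I.cost_convex.convex_le I.budget

theorem nonneg_of_mem_feasible {x : EuclideanSpace ℝ (Fin d)} (hx : x ∈ I.feasible) (j : Fin d) :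
    0 ≤ x j :=
  I.domain_nonneg x hx.1 j

theorem s_nonneg {x : EuclideanSpace ℝ (Fin d)} (hx : x ∈ I.feasible) : 0 ≤ I.s x :=
  mul_nonneg I.lam_nonneg (sub_nonneg.2 hx.2)

theorem s_sub_le (hp : p.Valid I) {x z : EuclideanSpace ℝ (Fin d)} (hx : x ∈ I.feasible)
    (hz : z ∈ I.feasible) : I.s z - I.s x ≤ I.lam * p.Lc * dist x z := by
  have h := hp.cost_lipschitz.dist_le_mul x hx.1 z hz.1
  rw [Real.dist_eq] at h
  have := mul_le_mul_of_nonneg_left ((le_abs_self _).trans h) I.lam_nonneg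
  unfold s
  linarith

theorem isCompact_feasible (hp : p.Valid I) (hclosed : IsClosed I.feasible) :
    IsCompact I.feasible :=
  Metric.isCompact_of_isClosed_isBounded hclosed
    (Metric.isBounded_iff.2 ⟨p.Δ, fun x hx y hy => hp.dist_le x hx y hy⟩)

/-- An optimal cover may have centres outside the feasible set. Projecting them onto it does not
increase their distances to feasible points, so the net becomes feasible with the same radius. -/
theorem exists_net (hp : p.Valid I) (hclosed : IsClosed I.feasible) {r : ℝ} (hr : 0 < r) :
    ∃ C : Finset (EuclideanSpace ℝ (Fin d)), (∀ z ∈ C, z ∈ I.feasible) ∧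
      (C.card : ℝ) ≤ I.covering r ∧ ∀ x ∈ I.feasible, ∃ z ∈ C, dist x z ≤ r := by
  classical
  have hr' : r.toNNReal ≠ 0 := by simpa using hr
  obtain ⟨N, -, hN, hcov⟩ :=
    Metric.exists_finite_isCover_of_isCompact hr' (isCompact_feasible hp hclosed)
  have : Nonempty {C // Metric.IsCover r.toNNReal I.feasible C} := ⟨⟨N, hcov⟩⟩
  -- The infimum that defines the covering number is attained; compactness makes it finite.
  obtain ⟨⟨C, hC⟩, hCeq⟩ := ENat.exists_eq_iInf
    fun C : {C // Metric.IsCover r.toNNReal I.feasible C} => C.1.encard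
  rw [iInf_subtype] at hCeq
  change C.encard = Metric.externalCoveringNumber r.toNNReal I.feasible at hCeq
  have hCfin : C.Finite := by
    rw [← Set.encard_lt_top_iff, hCeq]
    exact hcov.externalCoveringNumber_le_encard.trans_lt (Set.encard_lt_top_iff.2 hN)
  refine ⟨hCfin.toFinset.image (proj I.feasible), ?_, ?_, ?_⟩
  · intro z hz
    obtain ⟨y, -, rfl⟩ := Finset.mem_image.1 hz
    exact (proj_spec hclosed ⟨_, hp.x₀_mem⟩ y).1
  · unfold covering
    rw [← hCeq, hCfin.encard_eq_coe_toFinset_card, ENat.toNat_natCast]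
    exact_mod_cast Finset.card_image_le
  · intro x hx
    obtain ⟨y, hy, hxy⟩ := Set.mem_iUnion₂.1 (hC.subset_iUnion_closedBall hx)
    refine ⟨_, Finset.mem_image_of_mem _ (hCfin.mem_toFinset.2 hy), ?_⟩
    rw [dist_comm]
    refine (dist_proj_le hclosed I.feasible_convex hx y).trans ?_
    rw [Metric.mem_closedBall, Real.coe_toNNReal _ hr.le] at hxy
    rwa [dist_comm]

theorem one_le_covering (hp : p.Valid I) (hclosed : IsClosed I.feasible) {r : ℝ} (hr : 0 < r) :
    1 ≤ I.covering r := by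
  obtain ⟨C, -, hcard, hC⟩ := exists_net hp hclosed hr
  obtain ⟨z, hz, -⟩ := hC _ hp.x₀_mem
  refine le_trans ?_ hcard
  exact_mod_cast Finset.card_pos.2 ⟨z, hz⟩

theorem epsPrime_pos (hp : p.Valid I) : 0 < epsPrime p := by
  have := hp.ε_pos
  unfold epsPrime
  positivity

end Feasible

/-! ### The gradient algorithm -/

section Gradient

variable {V : Type*} [Fintype V] {d : ℕ} {I : CIMBS V d} {p : Input V d} {R : ℕ → Finset V}
  {θ : ℕ}

/-- For each RR set, $\min\{1,\cdot\}$ lies below the constant $1$, with supergradient $0$, and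
below the sum, with the summed supergradients; the algorithm uses the bound that is tight at `x`. -/
theorem gBar_add_s_le (hp : p.Valid I) {x y : EuclideanSpace ℝ (Fin d)} (hx : x ∈ I.feasible)
    (hy : y ∈ I.feasible) :
    I.gBar R θ y + I.s y ≤ I.gBar R θ x + I.s x + inner ℝ (subgrad I p R θ x) (y - x) := by
  have hs : I.s y ≤ I.s x - I.lam * inner ℝ (p.dc x) (y - x) := by
    have := mul_le_mul_of_nonneg_left (hp.dc_sub x hx.1 y hy.1) I.lam_nonneg
    unfold s
    linarith
  have hg : I.gBar R θ y ≤ I.gBar R θ x + (Fintype.card V : ℝ) / θ *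
      ∑ i ∈ Finset.range θ, inner ℝ (if 1 ≤ ∑ v ∈ R i, ∑ j, I.q v j (x j) then 0
      else WithLp.toLp 2 fun j => ∑ v ∈ R i, p.dq v j (x j)) (y - x) := by
    unfold gBar
    rw [← mul_add, ← Finset.sum_add_distrib]
    gcongr with i _
    split_ifs with h1
    · rw [min_eq_left h1, inner_zero_left, add_zero]
      exact min_le_left _ _
    · rw [min_eq_right (not_le.1 h1).le]
      refine (min_le_right _ _).trans ?_
      have hin : inner ℝ (WithLp.toLp 2 fun j => ∑ v ∈ R i, p.dq v j (x j)) (y - x) =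
          ∑ v ∈ R i, ∑ j, p.dq v j (x j) * (y j - x j) := by
        rw [PiLp.inner_apply, Finset.sum_comm]
        refine Finset.sum_congr rfl fun j _ => ?_
        simp [Finset.mul_sum, mul_comm]
      rw [hin, ← Finset.sum_add_distrib]
      refine Finset.sum_le_sum fun v _ => ?_
      rw [← Finset.sum_add_distrib]
      exact Finset.sum_le_sum fun j _ => hp.dq_super v j _ (nonneg_of_mem_feasible hx j) _
        (nonneg_of_mem_feasible hy j)
  unfold subgrad
  rw [inner_sub_left, real_inner_smul_left, real_inner_smul_left, sum_inner]
  linarith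

theorem norm_subgrad_le (hp : p.Valid I) {x : EuclideanSpace ℝ (Fin d)} (hx : x ∈ I.feasible) :
    ‖subgrad I p R θ x‖ ≤ lipBar I p R θ := by
  unfold subgrad lipBar
  refine (norm_sub_le _ _).trans (add_le_add ?_ ?_)
  · rw [norm_smul, Real.norm_of_nonneg (by positivity)]
    calc _ ≤ (Fintype.card V : ℝ) / θ *
          ∑ i ∈ Finset.range θ, √d * (((R i).card : ℝ) * p.Lq) := by
          gcongr
          refine (norm_sum_le _ _).trans (Finset.sum_le_sum fun i _ => ?_)
          split_ifs
          · rw [norm_zero]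
            positivity
          · refine norm_toLp_le (by positivity) fun j => (Finset.abs_sum_le_sum_abs _ _).trans ?_
            rw [← nsmul_eq_mul]
            exact Finset.sum_le_card_nsmul _ _ _ fun v _ =>
              hp.dq_bound v j _ (nonneg_of_mem_feasible hx j)
      _ = _ := by
          rw [← Finset.mul_sum, ← Finset.sum_mul, avgSize]
          ring
  · rw [norm_smul, Real.norm_of_nonneg I.lam_nonneg]
    exact mul_le_mul_of_nonneg_left (hp.dc_bound x hx.1) I.lam_nonneg

theorem iterate_mem_feasible (hp : p.Valid I) (hclosed : IsClosed I.feasible) (t : ℕ) :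
    iterate I p R θ t ∈ I.feasible := by
  cases t with
  | zero => exact hp.x₀_mem
  | succ t => exact (proj_spec hclosed ⟨_, hp.x₀_mem⟩ _).1

theorem best_mem_feasible (hp : p.Valid I) (hclosed : IsClosed I.feasible) (t : ℕ) :
    best I p R θ t ∈ I.feasible := by
  induction t with
  | zero => exact iterate_mem_feasible hp hclosed 0
  | succ t ih =>
    unfold best
    split_ifs
    · exact iterate_mem_feasible hp hclosed _
    · exact ih

theorem upperGrad_mem_feasible (hp : p.Valid I) (hclosed : IsClosed I.feasible) (δ : ℝ) :
    upperGrad I p R θ δ ∈ I.feasible :=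
  best_mem_feasible hp hclosed _

theorem iterate_le_best {t T : ℕ} (h : t ≤ T) :
    I.gBar R θ (iterate I p R θ t) + I.s (iterate I p R θ t) ≤
      I.gBar R θ (best I p R θ T) + I.s (best I p R θ T) := by
  induction T with
  | zero =>
    obtain rfl : t = 0 := Nat.le_zero.1 h
    exact le_rfl
  | succ T ih =>
    rw [best]
    rcases Nat.le_succ_iff.1 h with h | rfl
    · split_ifs with hlt
      · exact (ih h).trans hlt.le
      · exact ih h
    · split_ifs with hlt
      · exact le_rfl
      · exact not_lt.1 hlt

theorem lipBar_nonneg : 0 ≤ lipBar I p R θ := by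
  have := I.lam_nonneg
  unfold lipBar avgSize
  positivity

/-- The gradient algorithm maximizes `ḡ_R + s` up to an error of `δ / 2`. -/
theorem gBar_add_s_le_upperGrad (hp : p.Valid I) (hclosed : IsClosed I.feasible) {δ : ℝ}
    (hδ : 0 < δ) {y : EuclideanSpace ℝ (Fin d)} (hy : y ∈ I.feasible) :
    I.gBar R θ y + I.s y ≤ I.gBar R θ (upperGrad I p R θ δ) + I.s (upperGrad I p R θ δ) +
      δ / 2 := by
  unfold upperGrad
  set T := ⌈9 * (p.Δ * lipBar I p R θ) ^ 2 / δ ^ 2⌉₊ with hT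
  set L := lipBar I p R θ with hL
  set x := iterate I p R θ with hx
  set B := I.gBar R θ (best I p R θ T) + I.s (best I p R θ T) with hB
  have hxP : ∀ t, x t ∈ I.feasible := iterate_mem_feasible hp hclosed
  have hdist : ∀ t, dist (x t) y ≤ p.Δ := fun t => hp.dist_le _ (hxP t) _ hy
  have hL0 : 0 ≤ L := lipBar_nonneg
  have hΔ0 : 0 ≤ p.Δ := dist_nonneg.trans (hdist 0)
  have hγ : ∀ t ≤ T, I.gBar R θ y + I.s y - B ≤ inner ℝ (subgrad I p R θ (x t)) (y - x t) := by
    intro t ht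
    have h1 := gBar_add_s_le (R := R) (θ := θ) hp (hxP t) hy
    have h2 : _ ≤ B := iterate_le_best (I := I) (p := p) (R := R) (θ := θ) ht
    rw [← hx] at h2
    linarith
  set γ := I.gBar R θ y + I.s y - B with hγdef
  suffices 2 * γ ≤ δ by linarith
  -- If $\Delta L=0$ there are no iterations, and the step sizes may be quotients by $0$; but then
  -- gradient norm times distance already bounds the gap by $0$.
  rcases (mul_nonneg hΔ0 hL0).eq_or_lt with h0 | hpos
  · have h1 : γ ≤ L * p.Δ := calc
      γ ≤ ‖subgrad I p R θ (x 0)‖ * ‖y - x 0‖ := (hγ 0 T.zero_le).trans (real_inner_le_norm _ _)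
      _ ≤ L * p.Δ := by
        have h2 := norm_subgrad_le (R := R) (θ := θ) hp (hxP 0)
        have h3 := hdist 0
        rw [dist_comm, dist_eq_norm] at h3
        gcongr
    linarith [mul_comm L p.Δ]
  · have hΔ : 0 < p.Δ := hΔ0.lt_of_ne fun h => by simp [← h] at hpos
    have hLpos : 0 < L := hL0.lt_of_ne fun h => by simp [← h] at hpos
    have h := two_mul_le_of_subgradient_steps (x := x) (u := fun t => subgrad I p R θ (x t))
      hΔ hLpos hdist (fun t => norm_subgrad_le hp (hxP t))
      (fun t => dist_proj_le hclosed I.feasible_convex hy _) T hγ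
    set r := √(T : ℝ) with hr
    have hr2 : r ^ 2 = T := Real.sq_sqrt (by positivity)
    have hTle : 9 * (p.Δ * L) ^ 2 / δ ^ 2 ≤ T := Nat.le_ceil _
    -- The factor $9$ in the number of iterations: the gap satisfies $2\gamma\sqrt T\le3\Delta L$.
    have hrge : 3 * (p.Δ * L) / δ ≤ r := by
      refine Real.le_sqrt_of_sq_le ?_
      refine le_of_eq_of_le ?_ hTle
      rw [div_pow, mul_pow]
      norm_num
    have hr0 : 0 < r := lt_of_lt_of_le (by positivity) hrge
    have h1 : 2 * γ * r ≤ 3 * (p.Δ * L) := by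
      have h2 : L / p.Δ * (p.Δ ^ 2 - dist (x T) y ^ 2) * r ≤ L / p.Δ * p.Δ ^ 2 * r := by
        gcongr
        linarith [sq_nonneg (dist (x T) y)]
      have h3 : L / p.Δ * p.Δ ^ 2 * r = p.Δ * L * r := by field_simp
      rw [← hr2] at h
      nlinarith
    rw [div_le_iff₀ hδ] at hrge
    by_contra hcon
    push Not at hcon
    nlinarith

end Gradient

/-! ### Lipschitz bounds and existence of an optimum -/

section Lipschitz

variable {V : Type*} [Fintype V] {d : ℕ} {I : CIMBS V d} {p : Input V d} {R : ℕ → Finset V}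
  {θ : ℕ} {x z : EuclideanSpace ℝ (Fin d)}

theorem gHat_sub_le (hp : p.Valid I) (hx : x ∈ I.feasible) (hz : z ∈ I.feasible) :
    I.gHat R θ z - I.gHat R θ x ≤
      (Fintype.card V : ℝ) ^ 2 * p.Lq * ∑ j, max (z j - x j) 0 := by
  rw [gHat_eq, gHat_eq, ← mul_sub, ← Finset.sum_sub_distrib]
  set c := ∑ j, max (z j - x j) 0 with hc
  have hc0 : 0 ≤ c := Finset.sum_nonneg fun j _ => le_max_right _ _
  calc _ ≤ (Fintype.card V : ℝ) / θ *
        ∑ _i ∈ Finset.range θ, (Fintype.card V : ℝ) * (p.Lq * c) := by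
        gcongr with i _
        refine (hitProb_sub_le hp.q_lipschitz (nonneg_of_mem_feasible hx)
          (nonneg_of_mem_feasible hz) (R i)).trans ?_
        gcongr
        exact Finset.card_le_univ _
    _ = (θ : ℝ) / θ * ((Fintype.card V : ℝ) ^ 2 * p.Lq * c) := by
        rw [Finset.sum_const, Finset.card_range, nsmul_eq_mul]
        ring
    -- An inequality only, since the quotient is $0$ for $\theta=0$.
    _ ≤ 1 * ((Fintype.card V : ℝ) ^ 2 * p.Lq * c) := by
        gcongr
        exact div_self_le_one _
    _ = _ := one_mul _

theorem g_sub_le [Nonempty V] (hp : p.Valid I) (hx : x ∈ I.feasible) (hz : z ∈ I.feasible) :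
    I.g z - I.g x ≤ (Fintype.card V : ℝ) ^ 2 * p.Lq * ∑ j, max (z j - x j) 0 := by
  rw [g_eq_sum_rrLaw, g_eq_sum_rrLaw, ← mul_sub, ← Finset.sum_sub_distrib]
  simp only [← mul_sub]
  set c := ∑ j, max (z j - x j) 0 with hc
  have hc0 : 0 ≤ c := Finset.sum_nonneg fun j _ => le_max_right _ _
  calc _ ≤ (Fintype.card V : ℝ) *
        ∑ A, (I.model.rrLaw A).toReal * ((Fintype.card V : ℝ) * (p.Lq * c)) := by
        gcongr with A _
        refine (hitProb_sub_le hp.q_lipschitz (nonneg_of_mem_feasible hx)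
          (nonneg_of_mem_feasible hz) A).trans ?_
        gcongr
        exact Finset.card_le_univ _
    _ = _ := by
        rw [← Finset.sum_mul, TriggeringModel.sum_rrLaw_eq_one]
        ring

theorem gHat_add_s_sub_le (hp : p.Valid I) (hx : x ∈ I.feasible) (hz : z ∈ I.feasible) :
    I.gHat R θ z + I.s z - (I.gHat R θ x + I.s x) ≤ lip I p * dist x z := by
  have h1 := gHat_sub_le (R := R) (θ := θ) hp hx hz
  have h2 := s_sub_le hp hx hz
  have h3 := mul_le_mul_of_nonneg_left (sum_posPart_le x z)
    (show 0 ≤ (Fintype.card V : ℝ) ^ 2 * p.Lq by positivity)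
  unfold lip
  linarith

theorem g_add_s_sub_le [Nonempty V] (hp : p.Valid I) (hx : x ∈ I.feasible)
    (hz : z ∈ I.feasible) : I.g z + I.s z - (I.g x + I.s x) ≤ lip I p * dist x z := by
  have h1 := g_sub_le hp hx hz
  have h2 := s_sub_le hp hx hz
  have h3 := mul_le_mul_of_nonneg_left (sum_posPart_le x z)
    (show 0 ≤ (Fintype.card V : ℝ) ^ 2 * p.Lq by positivity)
  unfold lip
  linarith

/-- The estimation error `ĝ_R - g` has the same Lipschitz constant as `ĝ_R` and `g`, because both
are nondecreasing. -/
theorem gHat_sub_g_sub_le [Nonempty V] (hp : p.Valid I) (hx : x ∈ I.feasible)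
    (hz : z ∈ I.feasible) :
    I.gHat R θ z - I.g z - (I.gHat R θ x - I.g x) ≤ lip I p * dist x z := by
  have h1 := gHat_sub_le (R := R) (θ := θ) hp hx hz
  have h2 := g_sub_le hp hz hx
  have h3 := mul_le_mul_of_nonneg_left (sum_posPart_add_sum_posPart_le x z)
    (show 0 ≤ (Fintype.card V : ℝ) ^ 2 * p.Lq by positivity)
  have h4 : 0 ≤ I.lam * p.Lc * dist x z := by
    have := I.lam_nonneg
    positivity
  unfold lip
  linarith

theorem lip_nonneg : 0 ≤ lip I p := by
  have := I.lam_nonneg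
  unfold lip
  positivity

theorem g_nonneg [Nonempty V] (hx : x ∈ I.feasible) : 0 ≤ I.g x := by
  rw [g_eq_sum_rrLaw]
  exact mul_nonneg (by positivity) (Finset.sum_nonneg fun A _ =>
    mul_nonneg ENNReal.toReal_nonneg (hitProb_mem_Icc (nonneg_of_mem_feasible hx) A).1)

theorem exists_opt_eq [Nonempty V] (hp : p.Valid I) (hclosed : IsClosed I.feasible) :
    ∃ y ∈ I.feasible, I.opt = I.g y + I.s y ∧ ∀ x ∈ I.feasible, I.g x + I.s x ≤ I.opt := by
  have hcont : ContinuousOn (fun x => I.g x + I.s x) I.feasible := by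
    refine (LipschitzOnWith.of_dist_le_mul (K := ⟨lip I p, lip_nonneg⟩)
      fun x hx y hy => ?_).continuousOn
    rw [Real.dist_eq, abs_sub_le_iff]
    constructor
    · rw [dist_comm]
      exact g_add_s_sub_le hp hy hx
    · exact g_add_s_sub_le hp hx hy
  obtain ⟨y, hy, hmax⟩ := (isCompact_feasible hp hclosed).exists_isMaxOn ⟨_, hp.x₀_mem⟩ hcont
  have hgreatest : IsGreatest ((fun x => I.g x + I.s x) '' I.feasible) (I.g y + I.s y) :=
    ⟨⟨y, hy, rfl⟩, by rintro _ ⟨x, hx, rfl⟩; exact hmax hx⟩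
  have hopt : I.opt = I.g y + I.s y := hgreatest.csSup_eq
  exact ⟨y, hy, hopt, fun x hx => hopt ▸ hmax hx⟩

end Lipschitz

end CIMBS

/-! ### Constants, the sampling loop, and the deterministic core -/

theorem exp_neg_le_one_div {t K : ℝ} (hK : 0 < K) (h : Real.log K ≤ t) :
    Real.exp (-t) ≤ 1 / K := by
  calc Real.exp (-t) ≤ Real.exp (-Real.log K) := Real.exp_le_exp.2 (neg_le_neg h)
    _ = 1 / K := by rw [Real.exp_neg, Real.exp_log hK, one_div]

namespace CIMBS

theorem zero_lt_ratio : 0 < ratio := by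
  unfold ratio
  have h := Real.exp_one_gt_two
  have : 1 / Real.exp 1 < 1 := by rw [div_lt_one] <;> linarith
  linarith

theorem ratio_le_two_thirds : ratio ≤ 2 / 3 := by
  unfold ratio
  have h := Real.exp_one_lt_three
  have : 1 / 3 ≤ 1 / Real.exp 1 := one_div_le_one_div_of_le (Real.exp_pos 1) h.le
  linarith

section Deterministic

variable {V : Type*} [Fintype V] {d : ℕ} {I : CIMBS V d} {p : Input V d} {R : ℕ → Finset V}

theorem guess_pos [Nonempty V] (I : CIMBS V d) (i : ℕ) : 0 < I.guess i := by
  have h1 : (0 : ℝ) < Fintype.card V := by exact_mod_cast Fintype.card_pos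
  have h2 := mul_nonneg I.lam_nonneg I.budget_nonneg
  unfold guess
  positivity

theorem samplingLoop_pos [Nonempty V] (hp : p.Valid I) (m i : ℕ) :
    0 < samplingLoop I p R m i := by
  induction m generalizing i with
  | zero => exact one_pos
  | succ m ih =>
    rw [samplingLoop]
    split_ifs with h
    · have h1 := epsPrime_pos hp
      have h2 := hp.ε_pos
      have h3 := guess_pos I i
      exact div_pos (lt_of_lt_of_le (by positivity) h) (by positivity)
    · exact ih _

/-- The condition $a\ge1$ rules out the default value $1$ of the loop, so the value comes from a
round that passed its test. It is applied with $a=\mathrm{OPT}$. -/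
theorem exists_round_of_lt_samplingLoop (hp : p.Valid I) {a : ℝ} (ha : 1 ≤ a) {m i : ℕ}
    (h : a < samplingLoop I p R m i) :
    ∃ j ∈ Finset.Ico i (i + m), (1 + epsPrime p + p.ε / 3) * I.guess j ≤ roundValue I p R j ∧
      (1 + epsPrime p + p.ε / 3) * a ≤ roundValue I p R j := by
  induction m generalizing i with
  | zero => exact absurd h (not_lt.2 ha)
  | succ m ih =>
    rw [samplingLoop] at h
    split_ifs at h with hi
    · have h1 := epsPrime_pos hp
      have h2 := hp.ε_pos
      refine ⟨i, by simp, hi, ?_⟩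
      rw [lt_div_iff₀ (by positivity)] at h
      linarith
    · obtain ⟨j, hj, hj'⟩ := ih h
      refine ⟨j, ?_, hj'⟩
      rw [Finset.mem_Ico] at hj ⊢
      omega

/-- This and the next lemmas show that a computation with `θ` RR sets ignores the later terms of the
sequence, so that conditioning only involves finite tuples. -/
theorem lipBar_congr {R' : ℕ → Finset V} {θ : ℕ} (h : ∀ i < θ, R i = R' i) :
    lipBar I p R θ = lipBar I p R' θ := by
  unfold lipBar avgSize
  rw [Finset.sum_congr rfl fun i hi => by rw [h i (Finset.mem_range.1 hi)]]

theorem gHat_congr {R' : ℕ → Finset V} {θ : ℕ} (h : ∀ i < θ, R i = R' i) :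
    I.gHat R θ = I.gHat R' θ := by
  funext x
  unfold gHat
  rw [Finset.sum_congr rfl fun i hi => by rw [h i (Finset.mem_range.1 hi)]]

theorem gBar_congr {R' : ℕ → Finset V} {θ : ℕ} (h : ∀ i < θ, R i = R' i) :
    I.gBar R θ = I.gBar R' θ := by
  funext x
  unfold gBar
  rw [Finset.sum_congr rfl fun i hi => by rw [h i (Finset.mem_range.1 hi)]]

theorem subgrad_congr {R' : ℕ → Finset V} {θ : ℕ} (h : ∀ i < θ, R i = R' i) :
    subgrad I p R θ = subgrad I p R' θ := by
  funext x
  unfold subgrad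
  rw [Finset.sum_congr rfl fun i hi => by rw [h i (Finset.mem_range.1 hi)]]

theorem iterate_congr {R' : ℕ → Finset V} {θ : ℕ} (h : ∀ i < θ, R i = R' i) (t : ℕ) :
    iterate I p R θ t = iterate I p R' θ t := by
  induction t with
  | zero => rfl
  | succ t ih => rw [iterate, iterate, ih, lipBar_congr h, subgrad_congr h]

theorem best_congr {R' : ℕ → Finset V} {θ : ℕ} (h : ∀ i < θ, R i = R' i) (t : ℕ) :
    best I p R θ t = best I p R' θ t := by
  induction t with
  | zero => rfl
  | succ t ih => rw [best, best, ih, iterate_congr h, gBar_congr h]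

theorem upperGrad_congr {R' : ℕ → Finset V} {θ : ℕ} (h : ∀ i < θ, R i = R' i) (δ : ℝ) :
    upperGrad I p R θ δ = upperGrad I p R' θ δ := by
  rw [upperGrad, upperGrad, lipBar_congr h, best_congr h]

theorem samplingLoop_congr {R' : ℕ → Finset V} {m i N : ℕ} (h : ∀ i < N, R i = R' i)
    (hN : ∀ j < i + m, theta I p j ≤ N) :
    samplingLoop I p R m i = samplingLoop I p R' m i := by
  induction m generalizing i with
  | zero => rfl
  | succ m ih =>
    have h' : ∀ j < theta I p i, R j = R' j := fun j hj => h j (hj.trans_le (hN i (by omega)))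
    have hv : roundValue I p R i = roundValue I p R' i := by
      rw [roundValue, roundValue, gHat_congr h', upperGrad_congr h']
    rw [samplingLoop, samplingLoop, hv, ih fun j hj => hN j (by omega)]

/-- The lower bound depends on finitely many RR sets only. -/
theorem exists_lowerBound_congr (I : CIMBS V d) (p : Input V d) :
    ∃ N : ℕ, ∀ R R' : ℕ → Finset V, (∀ i < N, R i = R' i) →
      lowerBound I p R = lowerBound I p R' := by
  obtain ⟨N, hN⟩ := ((Set.finite_lt_nat
    (1 + ⌊Real.logb 2 ((Fintype.card V : ℝ) + I.lam * I.budget) - 1⌋₊)).image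
      (theta I p)).bddAbove
  exact ⟨N, fun R R' h => samplingLoop_congr h fun j hj => hN ⟨j, hj, rfl⟩⟩

/-- If the output of the gradient algorithm is bad although the optimal value is not
underestimated by much, then the value at some point of the net is overestimated. -/
theorem exists_net_point_of_lt [Nonempty V] (hclosed : IsClosed I.feasible) (hp : p.Valid I)
    (hlip : 0 < lip I p) (hεα : p.ε < ratio) {b : ℝ} (hb : 0 < b) (hbopt : b ≤ I.opt) {θ : ℕ}
    {y : EuclideanSpace ℝ (Fin d)} (hyP : y ∈ I.feasible) (hyopt : I.opt = I.g y + I.s y)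
    {C : Finset (EuclideanSpace ℝ (Fin d))} (hCP : ∀ z ∈ C, z ∈ I.feasible)
    (hC : ∀ x ∈ I.feasible, ∃ z ∈ C, dist x z ≤ p.ε / 3 / (lip I p + lip I p) * b)
    (hlo : I.g y - (ratio - p.ε / 3) * p.ε / 6 * I.opt < I.gHat R θ y)
    (hout : I.g (upperGrad I p R θ (p.ε * b)) + I.s (upperGrad I p R θ (p.ε * b)) <
      (ratio - p.ε) * I.opt) :
    ∃ z ∈ C, I.g z ≤ (ratio - 5 * p.ε / 6) * I.opt ∧
      I.g z + p.ε / 3 * I.opt ≤ I.gHat R θ z := by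
  have hα := ratio_le_two_thirds
  have hα0 := zero_lt_ratio
  have hε := hp.ε_pos
  set x := upperGrad I p R θ (p.ε * b) with hx
  have hxP : x ∈ I.feasible := upperGrad_mem_feasible hp hclosed _
  obtain ⟨z, hz, hxz⟩ := hC x hxP
  -- The net radius is built from $L_1+L_2$, twice the Lipschitz constant, hence $\varepsilon/6$.
  have hLr : lip I p * dist x z ≤ p.ε / 6 * b := by
    calc _ ≤ lip I p * (p.ε / 3 / (lip I p + lip I p) * b) := by gcongr
      _ = _ := by
        field_simp
        norm_num
  have h1 := gBar_add_s_le_upperGrad (R := R) (θ := θ) hp hclosed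
    (show 0 < p.ε * b by positivity) hyP
  rw [← hx] at h1
  have h2 := gHat_le_gBar (I := I) (nonneg_of_mem_feasible hyP) R θ
  have h3 := ratio_mul_gBar_le_gHat (I := I) (nonneg_of_mem_feasible hxP) R θ
  have hzx := gHat_sub_g_sub_le (R := R) (θ := θ) hp (hCP z hz) hxP
  rw [dist_comm] at hzx
  have hgz := g_add_s_sub_le hp hxP (hCP z hz)
  have hsz := s_nonneg (hCP z hz)
  have hsx := s_nonneg hxP
  refine ⟨z, hz, ?_⟩
  generalize I.gHat R θ z = hatz at *
  generalize I.gHat R θ x = hatx at *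
  generalize I.gHat R θ y = haty at *
  generalize I.gBar R θ x = barx at *
  generalize I.gBar R θ y = bary at *
  generalize lip I p * dist x z = e at *
  generalize I.g z = gz at *
  generalize I.g x = gx at *
  generalize I.s z = sz at *
  generalize I.s x = sx at *
  generalize ratio = α at *
  generalize p.ε = ε at *
  generalize I.opt = opt at *
  have hopt0 : 0 < opt := hb.trans_le hbopt
  -- The ratio $\alpha$ is lost on $\hat g$ only; $s\ge0$ extends it to the sum.
  have h4 : α * sx ≤ sx := mul_le_of_le_one_left hsx (by linarith)
  have h5 : α * ((1 - (α - ε / 3) * ε / 6) * opt - ε * b / 2) ≤ α * (barx + sx) := by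
    gcongr
    linarith
  have hεb : ε * b ≤ ε * opt := by gcongr
  have hαεb : α * (ε * b) ≤ 2 / 3 * (ε * opt) := by gcongr
  have hαα : α * (α - ε / 3) ≤ 2 / 3 * (2 / 3) := by
    gcongr
    · linarith
    · linarith
  have hεopt : 0 < ε * opt := by positivity
  have hαε₁ : α * (α - ε / 3) * (ε * opt) ≤ 2 / 3 * (2 / 3) * (ε * opt) := by gcongr
  -- In units of $\mathrm{OPT}$: $(\hat g+s)(x)$ falls short of $\alpha$ by at most
  -- $2\varepsilon/27$ (estimate at the optimum) plus $\varepsilon/3$ (optimization). So $\hat g-g$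
  -- exceeds $16\varepsilon/27$ at $x$, and moving to $z$ costs at most $\varepsilon/6$, which
  -- leaves more than $\varepsilon/3$.
  constructor <;> linarith

end Deterministic

/-! ### Failure probabilities of the two phases -/

section Probability

variable {V : Type*} [Fintype V] [Nonempty V] {d : ℕ} {I : CIMBS V d} {p : Input V d}
  {Ω : Type*} [MeasurableSpace Ω] {μ : Measure Ω} {R : ℕ → Ω → Finset V}
  {x : EuclideanSpace ℝ (Fin d)}

theorem integral_hitProb {A : Ω → Finset V} (hA : Measurable A)
    (hlaw : μ.map A = I.model.rrLaw.toMeasure) (x : EuclideanSpace ℝ (Fin d)) :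
    ∫ ω, I.hitProb (A ω) x ∂μ = I.g x / Fintype.card V := by
  have hf : Measurable fun B : Finset V => I.hitProb B x := .of_discrete
  rw [← integral_map (f := fun B => I.hitProb B x) hA.aemeasurable hf.aestronglyMeasurable, hlaw,
    PMF.integral_eq_sum, g_eq_sum_rrLaw, mul_div_cancel_left₀ _ (by simp)]
  simp

variable [IsProbabilityMeasure μ]

theorem measure_gHat_ge_le (hR : ∀ i, Measurable (R i))
    (hlaw : ∀ i, μ.map (R i) = I.model.rrLaw.toMeasure) (hind : iIndepFun R μ)
    (hx : x ∈ I.feasible) {M a : ℝ} (hM : 0 < M) (ha : 0 < a) (hgM : I.g x ≤ M) {θ : ℕ}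
    (hθ : 0 < θ) :
    μ.real {ω | I.g x + a ≤ I.gHat (fun i => R i ω) θ x} ≤
      Real.exp (-(θ * (a ^ 2 / ((Fintype.card V : ℝ) * (2 * M + 2 / 3 * a))))) := by
  have hn : (0 : ℝ) < Fintype.card V := by exact_mod_cast Fintype.card_pos
  have hf : Measurable fun B : Finset V => I.hitProb B x := .of_discrete
  have h := measure_sum_ge_le (X := fun i ω => I.hitProb (R i ω) x)
    (p := I.g x / Fintype.card V) (m := M / Fintype.card V) (a := a / Fintype.card V)
    (hind.comp (fun _ B => I.hitProb B x) fun _ => hf) (fun i => hf.comp (hR i))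
    (fun i ω => hitProb_mem_Icc (nonneg_of_mem_feasible hx) _)
    (fun i => integral_hitProb (hR i) (hlaw i) x) (by gcongr) (by positivity) (by positivity) θ
  refine le_of_le_of_eq ((measureReal_mono (fun ω hω => ?_) (measure_ne_top _ _)).trans h) ?_
  · simp only [Set.mem_ofPred_eq, gHat_eq] at hω ⊢
    have hθ' : (0 : ℝ) < θ := by exact_mod_cast hθ
    have := mul_le_mul_of_nonneg_left hω (show 0 ≤ (θ : ℝ) / Fintype.card V by positivity)
    refine le_of_eq_of_le ?_ (this.trans_eq ?_)
    · ring
    · field_simp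
  · congr 3
    field_simp

theorem measure_gHat_le_le (hR : ∀ i, Measurable (R i))
    (hlaw : ∀ i, μ.map (R i) = I.model.rrLaw.toMeasure) (hind : iIndepFun R μ)
    (hx : x ∈ I.feasible) {M a : ℝ} (hM : 0 < M) (ha : 0 < a) (hgM : I.g x ≤ M) {θ : ℕ}
    (hθ : 0 < θ) :
    μ.real {ω | I.gHat (fun i => R i ω) θ x ≤ I.g x - a} ≤
      Real.exp (-(θ * (a ^ 2 / ((Fintype.card V : ℝ) * (2 * M))))) := by
  have hn : (0 : ℝ) < Fintype.card V := by exact_mod_cast Fintype.card_pos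
  have hf : Measurable fun B : Finset V => I.hitProb B x := .of_discrete
  have h := measure_sum_le_le (X := fun i ω => I.hitProb (R i ω) x)
    (p := I.g x / Fintype.card V) (m := M / Fintype.card V) (a := a / Fintype.card V)
    (hind.comp (fun _ B => I.hitProb B x) fun _ => hf) (fun i => hf.comp (hR i))
    (fun i ω => hitProb_mem_Icc (nonneg_of_mem_feasible hx) _)
    (fun i => integral_hitProb (hR i) (hlaw i) x) (by gcongr) (by positivity) (by positivity) θ
  refine le_of_le_of_eq ((measureReal_mono (fun ω hω => ?_) (measure_ne_top _ _)).trans h) ?_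
  · simp only [Set.mem_ofPred_eq, gHat_eq] at hω ⊢
    have hθ' : (0 : ℝ) < θ := by exact_mod_cast hθ
    have := mul_le_mul_of_nonneg_left hω (show 0 ≤ (θ : ℝ) / Fintype.card V by positivity)
    refine le_of_eq_of_le ?_ (this.trans_eq ?_)
    · field_simp
    · ring
  · congr 3
    field_simp

/-- In a round of the sampling phase, the probability of an estimate that exceeds both the guess
and the optimal value is small. -/
theorem measure_round_le (hclosed : IsClosed I.feasible) (hp : p.Valid I)
    (hlip : 0 < lip I p) (hR : ∀ i, Measurable (R i))
    (hlaw : ∀ i, μ.map (R i) = I.model.rrLaw.toMeasure) (hind : iIndepFun R μ)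
    (hlog : 2 ≤ Real.logb 2 ((Fintype.card V : ℝ) + I.lam * I.budget)) (i : ℕ) :
    μ.real {ω | (1 + epsPrime p + p.ε / 3) * I.guess i ≤ roundValue I p (fun i => R i ω) i ∧
        (1 + epsPrime p + p.ε / 3) * I.opt ≤ roundValue I p (fun i => R i ω) i} ≤
      1 / ((Fintype.card V : ℝ) ^ p.ℓ * 2 *
        Real.logb 2 ((Fintype.card V : ℝ) + I.lam * I.budget)) := by
  classical
  obtain ⟨-, -, -, hmax⟩ := exists_opt_eq hp hclosed
  have hε := hp.ε_pos
  have hε' := epsPrime_pos hp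
  have hxi := guess_pos I i
  have hn : (0 : ℝ) < Fintype.card V := by exact_mod_cast Fintype.card_pos
  have hn1 : (1 : ℝ) ≤ Fintype.card V := by exact_mod_cast Fintype.card_pos
  set ε' := epsPrime p with hε'def
  set xi := I.guess i with hxidef
  set W := Real.logb 2 ((Fintype.card V : ℝ) + I.lam * I.budget) with hW
  -- `M` bounds $g$ on the feasible set, and it is at least $x_i$, so the sample size chosen for
  -- $x_i$ suffices for deviation $\varepsilon'M$.
  set M := max xi I.opt with hMdef
  have hM : 0 < M := lt_max_of_lt_left hxi
  set r := p.ε / 3 / lip I p * xi with hrdef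
  have hr : 0 < r := by positivity
  obtain ⟨C, hCP, hCcard, hC⟩ := exists_net hp hclosed hr
  have hN1 : 1 ≤ I.covering r := one_le_covering hp hclosed hr
  set N := I.covering r with hNdef
  set K := (Fintype.card V : ℝ) ^ p.ℓ * 2 * W with hK
  have hK0 : 0 < K := by positivity
  have hnum : Real.log N + p.ℓ * Real.log (Fintype.card V) + Real.log 2 + Real.log W =
      Real.log (N * K) := by
    rw [hK, Real.log_mul (by positivity) (by positivity),
      Real.log_mul (by positivity) (by positivity), Real.log_mul (by positivity) (by positivity),
      Real.log_rpow hn]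
    ring
  have hlogpos : 0 < Real.log (N * K) := by
    rw [← hnum]
    have h1 := Real.log_nonneg hN1
    have h2 := mul_nonneg hp.ℓ_pos.le (Real.log_nonneg hn1)
    have h3 := Real.log_pos one_lt_two
    have h4 := Real.log_nonneg (show 1 ≤ W by linarith)
    linarith
  have hθle : (Fintype.card V : ℝ) * (2 + 2 / 3 * ε') * Real.log (N * K) / (ε' ^ 2 * xi) ≤
      theta I p i := by
    rw [← hnum]
    exact Nat.le_ceil _
  have hθ : 0 < theta I p i := by
    have : (0 : ℝ) < theta I p i := lt_of_lt_of_le (by positivity) hθle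
    exact_mod_cast this
  have htail : ∀ z ∈ C, μ.real {ω | I.g z + ε' * M ≤ I.gHat (fun i => R i ω) (theta I p i) z} ≤
      1 / (N * K) := by
    intro z hz
    have hzP := hCP z hz
    refine (measure_gHat_ge_le hR hlaw hind hzP hM (by positivity) ?_ hθ).trans
      (exp_neg_le_one_div (by positivity) ?_)
    · have := hmax z hzP
      have := s_nonneg hzP
      have := le_max_right xi I.opt
      linarith
    · have e : (ε' * M) ^ 2 / ((Fintype.card V : ℝ) * (2 * M + 2 / 3 * (ε' * M))) =
          ε' ^ 2 * M / ((Fintype.card V : ℝ) * (2 + 2 / 3 * ε')) := by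
        field_simp
      rw [e]
      calc Real.log (N * K) = (Fintype.card V : ℝ) * (2 + 2 / 3 * ε') * Real.log (N * K) /
            (ε' ^ 2 * xi) * (ε' ^ 2 * xi / ((Fintype.card V : ℝ) * (2 + 2 / 3 * ε'))) := by
            field_simp
        _ ≤ _ := by
            gcongr
            exact le_max_left _ _
  calc _ ≤ μ.real (⋃ z ∈ C, {ω | I.g z + ε' * M ≤ I.gHat (fun i => R i ω) (theta I p i) z}) := by
        refine measureReal_mono (fun ω hω => ?_) (measure_ne_top _ _)
        obtain ⟨h1, h2⟩ := hω
        have h12 : (1 + ε' + p.ε / 3) * M ≤ roundValue I p (fun i => R i ω) i := by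
          rcases max_choice xi I.opt with h | h
          · rw [hMdef, h]; exact h1
          · rw [hMdef, h]; exact h2
        unfold roundValue at h12
        set y := upperGrad I p (fun i => R i ω) (theta I p i) (p.ε * I.guess i / 3) with hy
        have hyP : y ∈ I.feasible := upperGrad_mem_feasible hp hclosed _
        obtain ⟨z, hz, hyz⟩ := hC y hyP
        refine Set.mem_biUnion hz ?_
        have h3 := gHat_add_s_sub_le (R := fun i => R i ω) (θ := theta I p i) hp (hCP z hz) hyP
        have h4 : lip I p * dist z y ≤ p.ε / 3 * xi := by
          rw [dist_comm]
          calc _ ≤ lip I p * r := by gcongr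
            _ = _ := by rw [hrdef]; field_simp
        have h5 : p.ε / 3 * xi ≤ p.ε / 3 * M := by
          gcongr
          exact le_max_left _ _
        have h6 := hmax z (hCP z hz)
        have h7 : I.opt ≤ M := le_max_right _ _
        simp only [Set.mem_ofPred_eq]
        linarith
    _ ≤ ∑ z ∈ C, μ.real {ω | I.g z + ε' * M ≤ I.gHat (fun i => R i ω) (theta I p i) z} :=
        measureReal_biUnion_finset_le _ _
    _ ≤ C.card * (1 / (N * K)) := by
        rw [← nsmul_eq_mul]
        exact Finset.sum_le_card_nsmul _ _ _ htail
    _ ≤ N * (1 / (N * K)) := by gcongr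
    _ = 1 / K := by field_simp

/-- The estimated lower bound is a lower bound of the optimal value, with high probability. -/
theorem measure_opt_lt_lowerBound_le (hclosed : IsClosed I.feasible) (hopt : 1 ≤ I.opt)
    (hp : p.Valid I) (hlip : 0 < lip I p) (hR : ∀ i, Measurable (R i))
    (hlaw : ∀ i, μ.map (R i) = I.model.rrLaw.toMeasure) (hind : iIndepFun R μ) :
    μ.real {ω | I.opt < lowerBound I p fun i => R i ω} ≤
      1 / (2 * (Fintype.card V : ℝ) ^ p.ℓ) := by
  have hn : (0 : ℝ) < Fintype.card V := by exact_mod_cast Fintype.card_pos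
  set W := Real.logb 2 ((Fintype.card V : ℝ) + I.lam * I.budget) with hW
  set m := ⌊W - 1⌋₊ with hm
  let B : ℕ → Set Ω := fun i =>
    {ω | (1 + epsPrime p + p.ε / 3) * I.guess i ≤ roundValue I p (fun i => R i ω) i ∧
      (1 + epsPrime p + p.ε / 3) * I.opt ≤ roundValue I p (fun i => R i ω) i}
  have hsub : μ.real {ω | I.opt < lowerBound I p fun i => R i ω} ≤
      ∑ i ∈ Finset.Ico 1 (1 + m), μ.real (B i) := by
    refine (measureReal_mono (fun ω hω => ?_) (measure_ne_top _ _)).trans (measureReal_biUnion_finset_le _ _)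
    obtain ⟨j, hj, hj'⟩ := exists_round_of_lt_samplingLoop hp hopt hω
    exact Set.mem_biUnion hj hj'
  refine hsub.trans ?_
  -- Without rounds $LB=1\le\mathrm{OPT}$. Otherwise $W\ge2$, so the term $\ln W$ in $\theta_i$ is
  -- nonnegative.
  rcases Nat.eq_zero_or_pos m with h0 | h0
  · rw [h0]
    simp
    positivity
  · have hW2 : 2 ≤ W := by
      have := (Nat.le_floor_iff' (show (1 : ℕ) ≠ 0 by simp)).1 (show 1 ≤ ⌊W - 1⌋₊ from h0)
      push_cast at this
      linarith
    have hmW : (m : ℝ) ≤ W := (Nat.floor_le (by linarith)).trans (by linarith)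
    calc _ ≤ (m : ℝ) * (1 / ((Fintype.card V : ℝ) ^ p.ℓ * 2 * W)) := by
          refine (Finset.sum_le_card_nsmul _ _ _ fun i _ =>
            measure_round_le hclosed hp hlip hR hlaw hind hW2 i).trans_eq ?_
          rw [nsmul_eq_mul, Nat.card_Ico, Nat.add_sub_cancel_left]
      _ ≤ W * (1 / ((Fintype.card V : ℝ) ^ p.ℓ * 2 * W)) := by gcongr
      _ = _ := by field_simp

/-- $\theta^{(2)}$ is large enough for Bernstein's inequality with mean bound
$(\alpha-\frac56\varepsilon)\mathrm{OPT}$ and deviation $\frac\varepsilon3\mathrm{OPT}$: its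
denominator constant $2\alpha-\frac{13}9\varepsilon$ is at most $2\alpha'$, and the accuracy used in
$\theta^{(2)}$ is at most $\varepsilon/3$. -/
theorem le_mul_of_overestimate_count {n ε α b opt θ l : ℝ} (hn : 0 < n) (hε : 0 < ε)
    (hεα : ε < α) (hα : α ≤ 2 / 3) (hb : 0 < b) (hbopt : b ≤ opt) (hl : 0 ≤ l)
    (hθ : 2 * (α - ε / 3) * n * l /
      ((ε / 3 - 1 / 4 * (α - ε / 3) ^ 2 * (ε / 3)) ^ 2 * b) ≤ θ) :
    l ≤ θ * ((ε / 3 * opt) ^ 2 /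
      (n * (2 * ((α - 5 * ε / 6) * opt) + 2 / 3 * (ε / 3 * opt)))) := by
  have hopt : 0 < opt := hb.trans_le hbopt
  have hεopt : 0 < ε * opt := by positivity
  have hM : 0 < (α - 5 * ε / 6) * opt := mul_pos (by linarith) hopt
  have hden : 2 * ((α - 5 * ε / 6) * opt) + 2 / 3 * (ε / 3 * opt) ≤ 2 * (α - ε / 3) * opt := by
    linarith
  have hα'0 : 0 < α - ε / 3 := by linarith
  have hα'1 : (α - ε / 3) ^ 2 ≤ 1 := pow_le_one₀ hα'0.le (by linarith)
  generalize α - ε / 3 = α' at *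
  have hε₂ : 0 < ε / 3 - 1 / 4 * α' ^ 2 * (ε / 3) ∧
      ε / 3 - 1 / 4 * α' ^ 2 * (ε / 3) ≤ ε / 3 := by
    have h1 : 0 ≤ α' ^ 2 * ε := by positivity
    have h2 : α' ^ 2 * ε ≤ 1 * ε := by gcongr
    constructor <;> linarith
  generalize ε / 3 - 1 / 4 * α' ^ 2 * (ε / 3) = ε₂ at *
  obtain ⟨hε₂0, hε₂le⟩ := hε₂
  have hθ0 : 0 ≤ θ := le_trans (by positivity) hθ
  calc l = 2 * α' * n * l / (ε₂ ^ 2 * b) * (ε₂ ^ 2 * b / (n * (2 * α'))) := by field_simp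
    _ ≤ θ * ((ε / 3) ^ 2 * opt / (n * (2 * α'))) := by gcongr
    _ = θ * ((ε / 3 * opt) ^ 2 / (n * (2 * α' * opt))) := by field_simp
    _ ≤ _ := by gcongr

/-- With a lower bound `b` of the optimal value, the gradient algorithm on fresh RR sets succeeds
with high probability. -/
theorem measure_upperGrad_lt_le (hclosed : IsClosed I.feasible) (hopt : 1 ≤ I.opt)
    (hp : p.Valid I) (hlip : 0 < lip I p) (hεα : p.ε < ratio) (hR : ∀ i, Measurable (R i))
    (hlaw : ∀ i, μ.map (R i) = I.model.rrLaw.toMeasure) (hind : iIndepFun R μ) {b : ℝ}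
    (hb : 0 < b) (hbopt : b ≤ I.opt) :
    μ.real {ω | I.g (upperGrad I p (fun i => R i ω) (thetaFinal I p b) (p.ε * b)) +
        I.s (upperGrad I p (fun i => R i ω) (thetaFinal I p b) (p.ε * b)) <
          (ratio - p.ε) * I.opt} ≤
      1 / (2 * (Fintype.card V : ℝ) ^ p.ℓ) := by
  classical
  obtain ⟨y, hyP, hyopt, hmax⟩ := exists_opt_eq hp hclosed
  have hε := hp.ε_pos
  have hn : (0 : ℝ) < Fintype.card V := by exact_mod_cast Fintype.card_pos
  have hn1 : (1 : ℝ) ≤ Fintype.card V := by exact_mod_cast Fintype.card_pos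
  have hα := ratio_le_two_thirds
  have hα0 := zero_lt_ratio
  have hopt0 : 0 < I.opt := by linarith
  set θ := thetaFinal I p b with hθdef
  set ε := p.ε with hεdef
  set α := ratio with hαdef
  set α' := α - ε / 3 with hα'
  have hα'0 : 0 < α' := by linarith
  -- Matched to $\theta^{(1)}$: $\theta^{(1)}\varepsilon_1^2b/(2n)=\ln(4n^\ell)$.
  set ε₁ := α' * ε / 6 with hε₁
  have hε₁0 : 0 < ε₁ := by positivity
  set M := (α - 5 * ε / 6) * I.opt with hM
  have hM0 : 0 < M := mul_pos (by linarith) hopt0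
  set a := ε / 3 * I.opt with ha
  have ha0 : 0 < a := by positivity
  set r := ε / 3 / (lip I p + lip I p) * b with hrdef
  have hr : 0 < r := by positivity
  obtain ⟨C, hCP, hCcard, hC⟩ := exists_net hp hclosed hr
  have hN1 : 1 ≤ I.covering r := one_le_covering hp hclosed hr
  set N := I.covering r with hNdef
  set K := 4 * (Fintype.card V : ℝ) ^ p.ℓ with hK
  have hK4 : 4 ≤ K := by
    have := Real.one_le_rpow hn1 hp.ℓ_pos.le
    linarith
  have hK0 : 0 < K := by linarith
  have hlogK : 0 < Real.log K := Real.log_pos (by linarith)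
  have hlogKN : 0 < Real.log (K * N) := Real.log_pos (by nlinarith)
  have hθ1 : theta1 I p b ≤ θ := (le_max_left _ _).trans (Nat.le_ceil _)
  have hθ2 : theta2 I p b ≤ θ := (le_max_right _ _).trans (Nat.le_ceil _)
  have hθ1eq : theta1 I p b = 8 * (Fintype.card V : ℝ) * Real.log K / (b * α' ^ 2 * ε ^ 2 / 9) :=
    rfl
  have hθ2eq : theta2 I p b = 2 * α' * (Fintype.card V : ℝ) * Real.log (K * N) /
      ((ε / 3 - 1 / 4 * α' ^ 2 * (ε / 3)) ^ 2 * b) := rfl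
  have hθ : 0 < θ := by
    have : (0 : ℝ) < θ := lt_of_lt_of_le (by rw [hθ1eq]; positivity) hθ1
    exact_mod_cast this
  have hlow : μ.real {ω | I.gHat (fun i => R i ω) θ y ≤ I.g y - ε₁ * I.opt} ≤ 1 / K := by
    refine (measure_gHat_le_le hR hlaw hind hyP hopt0 (by positivity) ?_ hθ).trans
      (exp_neg_le_one_div hK0 ?_)
    · have := s_nonneg hyP
      linarith
    · calc Real.log K = theta1 I p b * (ε₁ ^ 2 * b / ((Fintype.card V : ℝ) * 2)) := by
            rw [hθ1eq, hε₁]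
            field_simp
            norm_num
        _ ≤ θ * (ε₁ ^ 2 * I.opt / ((Fintype.card V : ℝ) * 2)) := by gcongr
        _ = _ := by field_simp
  have hup : ∀ z ∈ C.filter (fun z => I.g z ≤ M),
      μ.real {ω | I.g z + a ≤ I.gHat (fun i => R i ω) θ z} ≤ 1 / (K * N) := by
    intro z hz
    obtain ⟨hzC, hzM⟩ := Finset.mem_filter.1 hz
    refine (measure_gHat_ge_le hR hlaw hind (hCP z hzC) hM0 ha0 hzM hθ).trans
      (exp_neg_le_one_div (by positivity) ?_)
    exact le_mul_of_overestimate_count hn hε (by linarith) hα hb hbopt hlogKN.le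
      (hθ2eq ▸ hθ2)
  calc _ ≤ μ.real ({ω | I.gHat (fun i => R i ω) θ y ≤ I.g y - ε₁ * I.opt} ∪
        ⋃ z ∈ C.filter (fun z => I.g z ≤ M), {ω | I.g z + a ≤ I.gHat (fun i => R i ω) θ z}) := by
        refine measureReal_mono (fun ω hω => ?_) (measure_ne_top _ _)
        simp only [Set.mem_ofPred_eq] at hω
        by_cases hlo : I.gHat (fun i => R i ω) θ y ≤ I.g y - ε₁ * I.opt
        · exact Or.inl hlo
        · obtain ⟨z, hz, hzM, hza⟩ := exists_net_point_of_lt hclosed hp hlip hεα hb hbopt hyP hyopt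
            hCP hC (not_le.1 hlo) hω
          exact Or.inr (Set.mem_biUnion (Finset.mem_filter.2 ⟨hz, hzM⟩) hza)
    _ ≤ 1 / K + ∑ z ∈ C.filter (fun z => I.g z ≤ M),
          μ.real {ω | I.g z + a ≤ I.gHat (fun i => R i ω) θ z} :=
        (measureReal_union_le _ _).trans
          (add_le_add hlow (measureReal_biUnion_finset_le _ _))
    _ ≤ 1 / K + C.card * (1 / (K * N)) := by
        rw [← nsmul_eq_mul]
        gcongr
        refine (Finset.sum_le_card_nsmul _ _ _ hup).trans ?_
        gcongr
        exact Finset.filter_subset _ _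
    _ ≤ 1 / K + N * (1 / (K * N)) := by gcongr
    _ = _ := by
        rw [hK]
        field_simp
        norm_num

end Probability

end CIMBS

/-! ### Conditioning on the sampling phase, and the conclusion -/

/-- Total probability over the finitely many values of `Y`. Only the product formula for each value
is needed, not measurability of `E a`. -/
theorem measure_setOf_mem_comp_le {Ω α : Type*} [MeasurableSpace Ω] {μ : Measure Ω}
    [IsProbabilityMeasure μ] [Fintype α] [MeasurableSpace α] [MeasurableSingletonClass α]
    {Y : Ω → α} (hY : Measurable Y) {E : α → Set Ω} {c : ℝ}
    (hind : ∀ a, μ.real (Y ⁻¹' {a} ∩ E a) = μ.real (Y ⁻¹' {a}) * μ.real (E a))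
    (hE : ∀ a, μ.real (E a) ≤ c) : μ.real {ω | ω ∈ E (Y ω)} ≤ c := by
  have hsum : ∑ a, μ.real (Y ⁻¹' {a}) = 1 := by
    rw [sum_measureReal_preimage_singleton _ fun a _ => hY (measurableSet_singleton a)]
    simp
  calc μ.real {ω | ω ∈ E (Y ω)} ≤ μ.real (⋃ a ∈ Finset.univ, Y ⁻¹' {a} ∩ E a) := by
        refine measureReal_mono (fun ω hω => ?_) (measure_ne_top _ _)
        exact Set.mem_biUnion (Finset.mem_univ (Y ω)) ⟨rfl, hω⟩
    _ ≤ ∑ a, μ.real (Y ⁻¹' {a} ∩ E a) := measureReal_biUnion_finset_le _ _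
    _ ≤ ∑ a, μ.real (Y ⁻¹' {a}) * c := by
        refine Finset.sum_le_sum fun a _ => ?_
        rw [hind]
        exact mul_le_mul_of_nonneg_left (hE a) measureReal_nonneg
    _ = c := by rw [← Finset.sum_mul, hsum, one_mul]

namespace CIMBS

variable {V : Type*} [Fintype V] [Nonempty V] {d : ℕ} {I : CIMBS V d} {p : Input V d}
  {Ω : Type*} [MeasurableSpace Ω] {μ : Measure Ω} [IsProbabilityMeasure μ]
  {R R' : ℕ → Ω → Finset V}

/-- The fresh sample size and the error parameter depend on $LB$. Once the RR sets that determine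
$LB$ are fixed, both are constants and the bound for fixed $b$ applies, since the fresh sets are
independent of them. -/
theorem measure_upperGradRIS_lt_le (hclosed : IsClosed I.feasible) (hopt : 1 ≤ I.opt)
    (hp : p.Valid I) (hlip : 0 < lip I p) (hεα : p.ε < ratio) (hR : ∀ i, Measurable (R i))
    (hR' : ∀ i, Measurable (R' i)) (hlaw' : ∀ i, μ.map (R' i) = I.model.rrLaw.toMeasure)
    (hindep : iIndepFun (fun i : ℕ ⊕ ℕ => Sum.elim R R' i) μ) :
    μ.real {ω | lowerBound I p (fun i => R i ω) ≤ I.opt ∧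
        I.g (upperGradRIS I p (fun i => R i ω) fun i => R' i ω) +
          I.s (upperGradRIS I p (fun i => R i ω) fun i => R' i ω) < (ratio - p.ε) * I.opt} ≤
      1 / (2 * (Fintype.card V : ℝ) ^ p.ℓ) := by
  classical
  obtain ⟨N, hN⟩ := exists_lowerBound_congr I p
  have hmeas : ∀ i, Measurable (Sum.elim R R' i) := fun i => by
    cases i
    · exact hR _
    · exact hR' _
  -- Truncation to the first `N` sampling-phase RR sets, which determine $LB$, makes the
  -- conditioning variable finite-valued.
  let S : Finset (ℕ ⊕ ℕ) := (Finset.range N).image Sum.inl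
  let Y : Ω → S → Finset V := fun ω i => Sum.elim R R' i ω
  let fill : (S → Finset V) → ℕ → Finset V := fun a i =>
    if h : Sum.inl i ∈ S then a ⟨Sum.inl i, h⟩ else ∅
  let LB : (S → Finset V) → ℝ := fun a => lowerBound I p (fill a)
  have hLB : ∀ ω, lowerBound I p (fun i => R i ω) = LB (Y ω) := fun ω =>
    hN _ _ fun i hi => by simp [fill, Y, S, hi]
  let out : ℝ → (ℕ → Finset V) → EuclideanSpace ℝ (Fin d) := fun b A =>
    upperGrad I p A (thetaFinal I p b) (p.ε * b)
  let bad : ℝ → Set (ℕ → Finset V) := fun b =>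
    {A | I.g (out b A) + I.s (out b A) < (ratio - p.ε) * I.opt}
  let E : (S → Finset V) → Set Ω := fun a =>
    {ω | LB a ≤ I.opt ∧ (fun i => R' i ω) ∈ bad (LB a)}
  have hY : Measurable Y := measurable_pi_lambda _ fun i => hmeas i
  have hmain : μ.real {ω | ω ∈ E (Y ω)} ≤ 1 / (2 * (Fintype.card V : ℝ) ^ p.ℓ) := by
    refine measure_setOf_mem_comp_le hY (fun a => ?_) fun a => ?_
    · let T : Finset (ℕ ⊕ ℕ) := (Finset.range (thetaFinal I p (LB a))).image Sum.inr
      let Z : Ω → T → Finset V := fun ω i => Sum.elim R R' i ω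
      let fill' : (T → Finset V) → ℕ → Finset V := fun A i =>
        if h : Sum.inr i ∈ T then A ⟨Sum.inr i, h⟩ else ∅
      have hE : E a = Z ⁻¹' {A | LB a ≤ I.opt ∧ fill' A ∈ bad (LB a)} := by
        ext ω
        have : out (LB a) (fun i => R' i ω) = out (LB a) (fill' (Z ω)) :=
          upperGrad_congr (fun i hi => by simp [fill', Z, T, hi]) _
        simp only [E, bad, Set.mem_ofPred_eq, Set.mem_preimage, this]
      have hST : Disjoint S T := by
        rw [Finset.disjoint_left]
        simp [S, T]
      have h := (hindep.indepFun_finset S T hST hmeas).measure_inter_preimage_eq_mul {a}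
        {A | LB a ≤ I.opt ∧ fill' A ∈ bad (LB a)} (measurableSet_singleton a) .of_discrete
      rw [hE, measureReal_def, measureReal_def, measureReal_def, ← ENNReal.toReal_mul]
      exact congrArg ENNReal.toReal h
    · by_cases hle : LB a ≤ I.opt
      · refine (measureReal_mono (fun ω hω => hω.2) (measure_ne_top _ _)).trans
          (measure_upperGrad_lt_le hclosed hopt hp hlip hεα hR' hlaw'
          (iIndepFun.precomp (g := Sum.inr) Sum.inr_injective hindep) (samplingLoop_pos hp _ _) hle)
      -- An outcome with $LB>\mathrm{OPT}$ is not charged here: `E a` is empty.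
      · simp only [E, hle, false_and]
        simp
        positivity
  refine le_of_eq_of_le ?_ hmain
  simp only [hLB, upperGradRIS]
  rfl

end CIMBS


theorem theorem4 {V : Type*} [Fintype V] [Nonempty V] {d : ℕ} (I : CIMBS V d)
    (hclosed : IsClosed I.feasible) (hopt : 1 ≤ I.opt)
    (p : CIMBS.Input V d) (hp : p.Valid I)
    {Ω : Type*} [MeasurableSpace Ω] (μ : Measure Ω) [IsProbabilityMeasure μ]
    (R R' : ℕ → Ω → Finset V)
    (hR : ∀ i, Measurable (R i)) (hR' : ∀ i, Measurable (R' i))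
    (hlaw : ∀ i, μ.map (R i) = I.model.rrLaw.toMeasure)
    (hlaw' : ∀ i, μ.map (R' i) = I.model.rrLaw.toMeasure)
    (hindep : iIndepFun (fun i : ℕ ⊕ ℕ => Sum.elim R R' i) μ) :
    1 - 1 / (Fintype.card V : ℝ) ^ p.ℓ ≤
      μ.real {ω | I.upperGradRIS p (fun i => R i ω) (fun i => R' i ω) ∈ I.feasible ∧
        (1 - 1 / Real.exp 1 - p.ε) * I.opt ≤
          I.g (I.upperGradRIS p (fun i => R i ω) (fun i => R' i ω)) +
            I.s (I.upperGradRIS p (fun i => R i ω) (fun i => R' i ω))} := by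
  have hmem : ∀ ω, I.upperGradRIS p (fun i => R i ω) (fun i => R' i ω) ∈ I.feasible := fun ω =>
    CIMBS.upperGrad_mem_feasible hp hclosed _
  have hn : (0 : ℝ) < Fintype.card V := by exact_mod_cast Fintype.card_pos
  have hopt0 : 0 < I.opt := by linarith
  have hK : 0 < (Fintype.card V : ℝ) ^ p.ℓ := by positivity
  simp only [hmem, true_and]
  change _ ≤ μ.real {ω | (CIMBS.ratio - p.ε) * I.opt ≤ _}
  have hsure : (∀ x ∈ I.feasible, (CIMBS.ratio - p.ε) * I.opt ≤ I.g x + I.s x) →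
      1 - 1 / (Fintype.card V : ℝ) ^ p.ℓ ≤ μ.real {ω | (CIMBS.ratio - p.ε) * I.opt ≤
        I.g (I.upperGradRIS p (fun i => R i ω) (fun i => R' i ω)) +
          I.s (I.upperGradRIS p (fun i => R i ω) (fun i => R' i ω))} := by
    intro h
    have huniv : {ω | (CIMBS.ratio - p.ε) * I.opt ≤
        I.g (I.upperGradRIS p (fun i => R i ω) (fun i => R' i ω)) +
          I.s (I.upperGradRIS p (fun i => R i ω) (fun i => R' i ω))} = Set.univ :=
      Set.eq_univ_of_forall fun ω => h _ (hmem ω)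
    rw [huniv, probReal_univ]
    have : 0 < 1 / (Fintype.card V : ℝ) ^ p.ℓ := by positivity
    linarith
  -- For $\varepsilon\ge1-1/e$ the target is at most $0$, while $g+s\ge0$.
  rcases le_or_gt CIMBS.ratio p.ε with hε | hε
  · refine hsure fun x hx => ?_
    have h1 : (CIMBS.ratio - p.ε) * I.opt ≤ 0 :=
      mul_nonpos_of_nonpos_of_nonneg (by linarith) hopt0.le
    have h2 := CIMBS.g_nonneg hx
    have h3 := CIMBS.s_nonneg hx
    linarith
  -- If the Lipschitz constant is $0$, the net radii degenerate, but every feasible point is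
  -- optimal.
  rcases (CIMBS.lip_nonneg (I := I) (p := p)).eq_or_lt with hlip | hlip
  · refine hsure fun x hx => ?_
    obtain ⟨y, hy, hyopt, -⟩ := CIMBS.exists_opt_eq hp hclosed
    have h1 := CIMBS.g_add_s_sub_le hp hx hy
    rw [← hlip, zero_mul, ← hyopt] at h1
    have h2 : (CIMBS.ratio - p.ε) * I.opt ≤ 1 * I.opt := by
      have h3 := CIMBS.ratio_le_two_thirds
      have h4 := hp.ε_pos
      gcongr
      linarith
    linarith
  set good := {ω | (CIMBS.ratio - p.ε) * I.opt ≤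
    I.g (I.upperGradRIS p (fun i => R i ω) (fun i => R' i ω)) +
      I.s (I.upperGradRIS p (fun i => R i ω) (fun i => R' i ω))} with hgood
  have h1 := CIMBS.measure_opt_lt_lowerBound_le hclosed hopt hp hlip hR hlaw
    (iIndepFun.precomp (g := Sum.inl) Sum.inl_injective hindep)
  have h2 := CIMBS.measure_upperGradRIS_lt_le hclosed hopt hp hlip hε hR hR' hlaw' hindep
  have hbad : μ.real goodᶜ ≤ 1 / (2 * (Fintype.card V : ℝ) ^ p.ℓ) +
      1 / (2 * (Fintype.card V : ℝ) ^ p.ℓ) := by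
    refine (measureReal_mono (fun ω hω => ?_) (measure_ne_top _ _)).trans
      ((measureReal_union_le _ _).trans (add_le_add h1 h2))
    rcases lt_or_ge I.opt (I.lowerBound p fun i => R i ω) with h | h
    · exact Or.inl h
    · exact Or.inr ⟨h, not_le.1 hω⟩
  -- Subadditivity suffices, so measurability of `good` is not needed.
  have hall : (1 : ℝ) ≤ μ.real good + μ.real goodᶜ := by
    rw [← probReal_univ (μ := μ), ← Set.union_compl_self good]
    exact measureReal_union_le _ _
  have hsum : 1 / (2 * (Fintype.card V : ℝ) ^ p.ℓ) + 1 / (2 * (Fintype.card V : ℝ) ^ p.ℓ) =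
      1 / (Fintype.card V : ℝ) ^ p.ℓ := by
    field_simp
    norm_num
  linarith
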